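/- Let $X,Y,Z$ be random variables with finite ranges $\mathcal X,\mathcal Y,\mathcal Z$ and joint distribution $p=p_{XYZ}$. Logarithms are to base $2$, and $\mathrm{supp}[q]=\{a: q(a)>0\}$. *Support relation.* For distributions $q_{XY},p_{XY}$ on $\mathcal X\times\mathcal Y$ write $q_{XY}\blacktriangleleft p_{XY}$ if, possibly after exchanging the roles of $X$ and $Y$ in both distributions, $\mathrm{supp}[q_X]\subseteq\mathrm{supp}[p_X]$ and at least one of the following holds: (i) $q_{XY}$ is uncorrelated, i.e. $q_{XY}=q_X\,q_Y$; (ii) $\mathrm{supp}[q_Y]\subseteq\mathrm{supp}[p_Y]$; (iii) for every $y\in\mathrm{supp}[q_Y]\setminus\mathrm{supp}[p_Y]$, $H(X|Y=y)=0$ under $q_{XY}$. *Two-way key rate.* A protocol on $n$ copies consists of the following. There is an i.i.d. source $X^nY^nZ^n\sim p_{XYZ}^{n}$; Alice holds $X^n$ and local randomness $Q_A$, and Bob holds $Y^n$ and local randomness $Q_B$, where $Q_A$, $Q_B$ and $X^nY^nZ^n$ are mutually independent. Finitely many public messages $M=(M_1,\dots,M_r)$ with finite ranges are exchanged, each $M_i$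 being either a function of $(X^n,Q_A,M_1,\dots,M_{i-1})$ or a function of $(Y^n,Q_B,M_1,\dots,M_{i-1})$. There are outputs $f=f(X^n,Q_A,M)$ and $g=g(Y^n,Q_B,M)$ and a random variable $K$, all with values in a finite set $\mathcal K$. A number $R$ is achievable if for every $\epsilon>0$ there is an $N$ such that for every $n\ge N$ some such protocol satisfies $\Pr[f=g=K]>1-\epsilon$, $\ \log|\mathcal K|-H(K|Z^nM)<\epsilon$ and $\frac1n\log|\mathcal K|\ge R$. The two-way secret key rate $K(X:Y||Z)$ is the supremum of all achievable $R$. **Theorem.** Suppose that $p_{XY|Z=z_1}\blacktriangleleft p_{XY|Z=z_0}$ for some $z_0,z_1\in\mathcal Z$ of positive probability, and that there is a pair $(x,y)\in\mathrm{supp}[p_{X|Z=z_0}]\times\mathrm{supp}[p_{Y|Z=z_0}]$ with $p(x,y|z_1)>0$ but $p(x,y|z_0)=0$. Then $$K(X:Y||Z)<I(X:Y|Z).$$ -/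

import Mathlib

open MeasureTheory ProbabilityTheory

noncomputable section

/-! ### Finite distributions and their information measures (in bits) -/

/-- The support of a distribution on a finite set. -/
def supp {α : Type*} (q : α → ℝ) : Set α := {a | 0 < q a}

/-- First marginal of a joint distribution. -/
def margFst {α β : Type*} [Fintype β] (q : α × β → ℝ) (a : α) : ℝ := ∑ b, q (a, b)

/-- Second marginal of a joint distribution. -/
def margSnd {α β : Type*} [Fintype α] (q : α × β → ℝ) (b : β) : ℝ := ∑ a, q (a, b)

/-- The conditional distribution of the first component given that the second one equals `b`.
It is meaningful when `b` has positive probability (otherwise it is the zero function). -/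
def condFst {α β : Type*} [Fintype α] (q : α × β → ℝ) (b : β) (a : α) : ℝ :=
  q (a, b) / margSnd q b

/-- Shannon entropy `H(q) = - ∑ a, q a * log₂ (q a)`, with `0 log 0 = 0`. -/
def shannonEntropy {α : Type*} [Fintype α] (q : α → ℝ) : ℝ :=
  ∑ a, Real.negMulLog (q a) / Real.log 2

/-- Conditional entropy `H(A|B) = ∑ b, q_B(b) * H(A|B=b)` of a joint distribution of `(A, B)`. -/
def condEntropy {α β : Type*} [Fintype α] [Fintype β] (q : α × β → ℝ) : ℝ :=
  ∑ b, margSnd q b * shannonEntropy (condFst q b)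

/-- Mutual information `I(A:B) = H(A) + H(B) - H(AB)`. -/
def mutualInfo {α β : Type*} [Fintype α] [Fintype β] (q : α × β → ℝ) : ℝ :=
  shannonEntropy (margFst q) + shannonEntropy (margSnd q) - shannonEntropy q

/-- The marginal `p_Z` of a distribution `p_{XYZ}`. -/
def margZ {𝒳 𝒴 𝒵 : Type*} [Fintype 𝒳] [Fintype 𝒴] (p : 𝒳 × 𝒴 × 𝒵 → ℝ) (z : 𝒵) : ℝ :=
  ∑ x, ∑ y, p (x, y, z)

/-- The conditional distribution `p_{XY|Z=z}`, meaningful when `p_Z(z) > 0`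
(otherwise it is the zero function). -/
def condXY {𝒳 𝒴 𝒵 : Type*} [Fintype 𝒳] [Fintype 𝒴] (p : 𝒳 × 𝒴 × 𝒵 → ℝ) (z : 𝒵)
    (xy : 𝒳 × 𝒴) : ℝ :=
  p (xy.1, xy.2, z) / margZ p z

/-- Conditional mutual information `I(X:Y|Z) = ∑ z, p_Z(z) * I(X:Y|Z=z)`. -/
def condMutualInfo {𝒳 𝒴 𝒵 : Type*} [Fintype 𝒳] [Fintype 𝒴] [Fintype 𝒵]
    (p : 𝒳 × 𝒴 × 𝒵 → ℝ) : ℝ :=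
  ∑ z, margZ p z * mutualInfo (condXY p z)

/-! ### The support relation between two joint distributions -/

/-- `q` makes its two components independent. -/
def Uncorrelated {𝒳 𝒴 : Type*} [Fintype 𝒳] [Fintype 𝒴] (q : 𝒳 × 𝒴 → ℝ) : Prop :=
  ∀ x y, q (x, y) = margFst q x * margSnd q y

/-- `supp q_X ⊆ supp p_X`, together with one of: (i) `q` is uncorrelated,
(ii) `supp q_Y ⊆ supp p_Y`, (iii) `H(X|Y=y) = 0` under `q` for all
`y ∈ supp q_Y \ supp p_Y`. -/
def SuppBelowFst {𝒳 𝒴 : Type*} [Fintype 𝒳] [Fintype 𝒴] (q p : 𝒳 × 𝒴 → ℝ) : Prop :=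
  supp (margFst q) ⊆ supp (margFst p) ∧
    (Uncorrelated q ∨
      supp (margSnd q) ⊆ supp (margSnd p) ∨
      ∀ y ∈ supp (margSnd q) \ supp (margSnd p), shannonEntropy (condFst q y) = 0)

/-- The relation `q_{XY} ◀ p_{XY}`: `SuppBelowFst` holds, possibly after exchanging the roles
of `X` and `Y` (in both distributions). -/
def SuppBelow {𝒳 𝒴 : Type*} [Fintype 𝒳] [Fintype 𝒴] (q p : 𝒳 × 𝒴 → ℝ) : Prop :=
  SuppBelowFst q p ∨
    SuppBelowFst (fun yx : 𝒴 × 𝒳 => q yx.swap) (fun yx : 𝒴 × 𝒳 => p yx.swap)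

/-! ### Key agreement by public discussion -/

/-- The distribution of a finitely valued random variable. -/
def law {Ω α : Type*} [MeasurableSpace Ω] (μ : Measure Ω) (U : Ω → α) (a : α) : ℝ :=
  μ.real {ω | U ω = a}

/-- `W` is a function of the finitely valued variables `U`, `V` and of the local
randomness `Q`; the function is measurable in `Q`. -/
def IsFunctionOf {Ω α 𝒬 β γ : Type*} [MeasurableSpace 𝒬]
    (U : Ω → α) (Q : Ω → 𝒬) (V : Ω → β) (W : Ω → γ) : Prop :=
  ∃ φ : α → 𝒬 → β → γ,
    (∀ a b c, MeasurableSet {q | φ a q b = c}) ∧ ∀ ω, W ω = φ (U ω) (Q ω) (V ω)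

/-- A two-way key agreement protocol on `n` independent copies of the source `p_{XYZ}`: all
random variables live on one probability space `Ω`. Local randomness is arbitrary, the message
alphabet `Msg` and the key alphabet `Key` are finite. -/
structure KeyProtocol {𝒳 𝒴 𝒵 : Type*} (p : 𝒳 × 𝒴 × 𝒵 → ℝ) (n : ℕ) where
  /-- The probability space. -/
  Ω : Type
  [measurableSpaceΩ : MeasurableSpace Ω]
  μ : Measure Ω
  [isProbabilityMeasure : IsProbabilityMeasure μ]
  /-- Alice's, Bob's and Eve's source sequences `X^n`, `Y^n`, `Z^n`. -/
  X : Ω → Fin n → 𝒳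
  Y : Ω → Fin n → 𝒴
  Z : Ω → Fin n → 𝒵
  measurable_source : ∀ x y z, MeasurableSet {ω | (X ω, Y ω, Z ω) = (x, y, z)}
  /-- The source is i.i.d. with single-copy distribution `p`. -/
  law_source : ∀ x y z, law μ (fun ω => (X ω, Y ω, Z ω)) (x, y, z) = ∏ i, p (x i, y i, z i)
  /-- The local random variables `Q_A` and `Q_B`. -/
  RangeA : Type
  RangeB : Type
  [measurableSpaceA : MeasurableSpace RangeA]
  [measurableSpaceB : MeasurableSpace RangeB]
  QA : Ω → RangeA
  QB : Ω → RangeB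
  measurable_QA : Measurable QA
  measurable_QB : Measurable QB
  /-- `Q_A`, `Q_B` and `X^n Y^n Z^n` are mutually independent. -/
  indep : iIndep ![MeasurableSpace.comap QA measurableSpaceA,
    MeasurableSpace.comap QB measurableSpaceB,
    MeasurableSpace.comap (fun ω => (X ω, Y ω, Z ω)) ⊤] μ
  /-- The public messages `M_1, …, M_r`. -/
  rounds : ℕ
  Msg : Type
  [fintypeMsg : Fintype Msg]
  M : Fin rounds → Ω → Msg
  /-- In each round, one of the parties sends a function of its source sequence, its local
  randomness and the previous messages. -/
  isMessage : ∀ i : Fin rounds,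
    IsFunctionOf X QA (fun ω (j : Fin i) => M (j.castLE i.isLt.le) ω) (M i) ∨
    IsFunctionOf Y QB (fun ω (j : Fin i) => M (j.castLE i.isLt.le) ω) (M i)
  /-- The ideal key `K`, an arbitrary random variable with range in `Key`. -/
  Key : Type
  [fintypeKey : Fintype Key]
  K : Ω → Key
  measurable_K : ∀ k, MeasurableSet {ω | K ω = k}
  /-- Alice's and Bob's outputs `f(X^n, Q_A, M)` and `g(Y^n, Q_B, M)`. -/
  f : Ω → Key
  g : Ω → Key
  isOutput_f : IsFunctionOf X QA (fun ω i => M i ω) f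
  isOutput_g : IsFunctionOf Y QB (fun ω i => M i ω) g

attribute [instance] KeyProtocol.measurableSpaceΩ KeyProtocol.isProbabilityMeasure
  KeyProtocol.fintypeMsg KeyProtocol.fintypeKey

/-- `H(K | Z^n M)`: Eve's uncertainty about the key, given her source sequence and all public
messages. -/
def KeyProtocol.eveEntropy {𝒳 𝒴 𝒵 : Type*} [Fintype 𝒵] {p : 𝒳 × 𝒴 × 𝒵 → ℝ} {n : ℕ}
    (P : KeyProtocol p n) : ℝ :=
  condEntropy (law P.μ (fun ω => (P.K ω, (P.Z ω, fun i => P.M i ω))))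

/-- `R` is an achievable two-way secret key rate for `p_{XYZ}`. -/
def IsAchievableKeyRate {𝒳 𝒴 𝒵 : Type*} [Fintype 𝒵] (p : 𝒳 × 𝒴 × 𝒵 → ℝ) (R : ℝ) : Prop :=
  ∀ ε : ℝ, 0 < ε → ∃ N : ℕ, ∀ n : ℕ, N ≤ n → ∃ P : KeyProtocol p n,
    1 - ε < P.μ.real {ω | P.f ω = P.K ω ∧ P.g ω = P.K ω} ∧
    Real.logb 2 (Fintype.card P.Key) - P.eveEntropy < ε ∧
    R ≤ 1 / (n : ℝ) * Real.logb 2 (Fintype.card P.Key)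

/-- The two-way secret key rate `K(X:Y||Z)`: the supremum of all achievable rates, taken in the
extended reals. -/
def twoWayKeyRate {𝒳 𝒴 𝒵 : Type*} [Fintype 𝒵] (p : 𝒳 × 𝒴 × 𝒵 → ℝ) : EReal :=
  sSup ((fun R : ℝ => (R : EReal)) '' {R | IsAchievableKeyRate p R})

end

/-! The key rate is at most `I(X:Y|J)` for every variable `J` obtained from `Z` through a channel
`W`, so it suffices to find one channel with `I(X:Y|J) < I(X:Y|Z)`.

The channel sends `z₁` to `z₀` with a small probability `δ` and otherwise changes nothing. Write
`q₀`, `q₁` for the unnormalized slices of `p` at `z₀`, `z₁`. When `q₀` becomes `q₀ + δ q₁`, each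
entropy gains `-δ log δ` times the mass that `q₁` puts where `q₀` vanishes, up to `O(δ)`. In `H(X) +
H(Y) - H(XY)` one marginal contributes nothing, by inclusion of supports. The new mass of the other
marginal is also new in the joint distribution, which has in addition the atom `(x, y)`. The
information thus drops by at least `q₁(x, y) (-δ log δ)`, which beats every `O(δ)` term
(`eventually_infoSum_add_smul_lt`).

The upper bound is a change of measure. For fixed source values, transcript and outputs have
probability `α(x, m, u) β(y, m, v)`. If `X` and `Y` were independent given `J`, so would be the two
outputs given `J` and the transcript, and agreement would be no likelier than guessing. A
Donsker-Varadhan inequality transfers this to the true source at the cost of the relative entropy `n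
I(X:Y|J)` and a constant (`condEntropy_le_of_factorization`,
`KeyProtocol.eveEntropy_mul_log_two_le`). -/

/-! ### Entropy expansions at the boundary of the simplex. -/

-- Away from zero `negMulLog` is differentiable, so the increment is linear. At zero, `negMulLog (δ
-- * b)` splits exactly into `b * negMulLog δ` and a linear term.
open Filter Asymptotics Topology in
theorem isBigO_negMulLog_add_mul (a b : ℝ) (ha : 0 ≤ a) :
    (fun δ : ℝ => Real.negMulLog (a + δ * b) - Real.negMulLog a
      - (if a = 0 then b else 0) * Real.negMulLog δ) =O[𝓝[>] 0] (fun δ => δ) := by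
  by_cases h : a = 0
  · subst h
    simp only [zero_add, Real.negMulLog_mul, if_true, Real.negMulLog_zero, sub_zero,
      add_sub_cancel_left]
    simpa [mul_comm] using (isBigO_refl (fun δ : ℝ => δ) (𝓝[>] (0 : ℝ))).const_mul_left
      (Real.negMulLog b)
  · simp only [h, if_false, zero_mul, sub_zero]
    have h1 : DifferentiableAt ℝ (fun δ : ℝ => Real.negMulLog (a + δ * b)) 0 := by
      apply DifferentiableAt.comp (g := Real.negMulLog)
      · simpa using Real.differentiableAt_negMulLog h
      · fun_prop
    have := h1.isBigO_sub.mono (nhdsWithin_le_nhds (s := Set.Ioi (0 : ℝ)))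
    simpa using this

-- The coefficient of `negMulLog δ` is the mass of `b` off the support of `a`.
open Filter Asymptotics Topology in
theorem isBigO_sum_negMulLog_add_mul {α : Type*} [Fintype α] (a b : α → ℝ) (ha : ∀ i, 0 ≤ a i) :
    (fun δ : ℝ => ∑ i, Real.negMulLog (a i + δ * b i) - ∑ i, Real.negMulLog (a i)
      - (∑ i, if a i = 0 then b i else 0) * Real.negMulLog δ) =O[𝓝[>] 0] (fun δ => δ) := by
  have := IsBigO.sum (s := Finset.univ) fun i _ => isBigO_negMulLog_add_mul (a i) (b i) (ha i)
  refine this.congr_left fun δ => ?_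
  simp only [Finset.sum_apply, Finset.sum_sub_distrib, ← Finset.sum_mul]

/-! ### Mutual information of unnormalized distributions. -/

/-- The mutual information, in nats, of a not necessarily normalized joint distribution. -/
noncomputable def infoSum {α β : Type*} [Fintype α] [Fintype β] (q : α × β → ℝ) : ℝ :=
  ∑ x, ∑ y, q (x, y) * Real.log (q (x, y) / (margFst q x / (∑ b, margSnd q b) * margSnd q y))

section
variable {α β : Type*} [Fintype α] [Fintype β]

theorem margFst_nonneg {α β : Type*} [Fintype β] {q : α × β → ℝ} (hq : ∀ a, 0 ≤ q a) (x : α) : 0 ≤ margFst q x :=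
  Finset.sum_nonneg fun _ _ => hq _

theorem margSnd_nonneg {α β : Type*} [Fintype α] {q : α × β → ℝ} (hq : ∀ a, 0 ≤ q a) (y : β) : 0 ≤ margSnd q y :=
  Finset.sum_nonneg fun _ _ => hq _

theorem margFst_pos {α β : Type*} [Fintype β] {q : α × β → ℝ} (hq : ∀ a, 0 ≤ q a) {x : α} {y : β} (h : 0 < q (x, y)) :
    0 < margFst q x :=
  h.trans_le (Finset.single_le_sum (f := fun b => q (x, b)) (fun _ _ => hq _) (Finset.mem_univ y))

theorem margSnd_pos {α β : Type*} [Fintype α] {q : α × β → ℝ} (hq : ∀ a, 0 ≤ q a) {x : α} {y : β} (h : 0 < q (x, y)) :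
    0 < margSnd q y :=
  h.trans_le (Finset.single_le_sum (f := fun b => q (b, y)) (fun _ _ => hq _) (Finset.mem_univ x))

theorem sum_margSnd_pos {q : α × β → ℝ} (hq : ∀ a, 0 ≤ q a) {y : β} (h : 0 < margSnd q y) :
    0 < ∑ b, margSnd q b :=
  h.trans_le (Finset.single_le_sum (f := margSnd q) (fun _ _ => margSnd_nonneg hq _)
    (Finset.mem_univ y))

theorem sum_margSnd (q : α × β → ℝ) : ∑ b, margSnd q b = ∑ a, q a := by
  simp [margSnd, Fintype.sum_prod_type_right]

/-- This form lets the entropy expansions be applied term by term. The last term accounts for the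
total mass and vanishes for probability distributions. -/
theorem infoSum_eq {q : α × β → ℝ} (hq : ∀ a, 0 ≤ q a) :
    infoSum q = ∑ x, Real.negMulLog (margFst q x) + ∑ y, Real.negMulLog (margSnd q y)
      - ∑ a, Real.negMulLog (q a) - Real.negMulLog (∑ b, margSnd q b) := by
  have key : ∀ x y, q (x, y) * Real.log (q (x, y) /
      (margFst q x / (∑ b, margSnd q b) * margSnd q y))
      = - (q (x, y) * Real.log (margFst q x)) - q (x, y) * Real.log (margSnd q y)
        - Real.negMulLog (q (x, y)) + q (x, y) * Real.log (∑ b, margSnd q b) := by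
    intro x y
    rcases (hq (x, y)).eq_or_lt with h | h
    · simp [← h]
    · have h1 := margFst_pos hq h
      have h2 := margSnd_pos hq h
      have h3 := sum_margSnd_pos hq h2
      rw [Real.log_div h.ne' (by positivity), Real.log_mul (by positivity) h2.ne',
        Real.log_div h1.ne' h3.ne', Real.negMulLog]
      ring
  have e1 : ∑ x, ∑ y, q (x, y) * Real.log (margFst q x)
      = - ∑ x, Real.negMulLog (margFst q x) := by
    simp_rw [← Finset.sum_mul, Real.negMulLog, neg_mul, Finset.sum_neg_distrib, neg_neg]
    rfl
  have e2 : ∑ x, ∑ y, q (x, y) * Real.log (margSnd q y)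
      = - ∑ y, Real.negMulLog (margSnd q y) := by
    rw [Finset.sum_comm]
    simp_rw [← Finset.sum_mul, Real.negMulLog, neg_mul, Finset.sum_neg_distrib, neg_neg]
    rfl
  have e3 : ∑ x, ∑ y, q (x, y) * Real.log (∑ b, margSnd q b)
      = - Real.negMulLog (∑ b, margSnd q b) := by
    simp_rw [← Finset.sum_mul, Real.negMulLog, neg_mul, neg_neg]
    congr 1
    rw [sum_margSnd, Fintype.sum_prod_type]
  simp only [infoSum, key, Finset.sum_add_distrib, Finset.sum_sub_distrib, Finset.sum_neg_distrib,
    e1, e2, e3, Fintype.sum_prod_type]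
  ring

theorem infoSum_swap {q : α × β → ℝ} (hq : ∀ a, 0 ≤ q a) :
    infoSum (fun yx : β × α => q yx.swap) = infoSum q := by
  rw [infoSum_eq hq, infoSum_eq (fun _ => hq _), sum_margSnd, sum_margSnd]
  have h1 : ∑ a : β × α, Real.negMulLog (q a.swap) = ∑ a, Real.negMulLog (q a) :=
    (Equiv.prodComm β α).sum_comp (fun a => Real.negMulLog (q a))
  have h2 : ∑ a : β × α, q a.swap = ∑ a, q a :=
    (Equiv.prodComm β α).sum_comp q
  rw [h1, h2]
  have h3 : margFst (fun yx : β × α => q yx.swap) = margSnd q := rfl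
  have h4 : margSnd (fun yx : β × α => q yx.swap) = margFst q := rfl
  rw [h3, h4]
  ring

/-- Homogeneity makes it free to split a symbol of `Z` into proportional copies. -/
theorem infoSum_smul (q : α × β → ℝ) (t : ℝ) :
    infoSum (fun a => t * q a) = t * infoSum q := by
  by_cases ht : t = 0
  · simp [infoSum, ht]
  have h1 : margFst (fun a => t * q a) = fun x => t * margFst q x := by
    ext x; simp [margFst, Finset.mul_sum]
  have h2 : margSnd (fun a => t * q a) = fun x => t * margSnd q x := by
    ext x; simp [margSnd, Finset.mul_sum]
  have h3 : ∀ a b c d : ℝ, t * a / (t * b / (t * c) * (t * d)) = a / (b / c * d) := by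
    intro a b c d
    rw [mul_div_mul_left _ _ ht, mul_left_comm, mul_div_mul_left _ _ ht]
  simp only [infoSum, h1, h2, ← Finset.mul_sum, mul_assoc, h3]

theorem mul_mutualInfo_eq_infoSum {q : α × β → ℝ} (hq : ∀ a, 0 ≤ q a) :
    (∑ a, q a) * mutualInfo (fun a => q a / ∑ a, q a) = infoSum q / Real.log 2 := by
  set s := ∑ a, q a with hs
  have hs0 : 0 ≤ s := Finset.sum_nonneg fun _ _ => hq _
  rcases hs0.eq_or_lt with h | h
  · have : ∀ a, q a = 0 := by
      intro a
      exact (Finset.sum_eq_zero_iff_of_nonneg (fun _ _ => hq _)).1 h.symm a (Finset.mem_univ a)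
    simp [← h, infoSum, this]
  · have h0 : (fun a => q a / s) = fun a => s⁻¹ * q a := by ext a; ring
    have h1 : infoSum (fun a => q a / s) = s⁻¹ * infoSum q := by rw [h0, infoSum_smul]
    have h2 : infoSum q = s * infoSum (fun a => q a / s) := by rw [h1]; field_simp
    rw [h2, infoSum_eq (fun a => div_nonneg (hq a) hs0), sum_margSnd, ← Finset.sum_div, ← hs,
      div_self h.ne', Real.negMulLog_one]
    simp only [mutualInfo, shannonEntropy, ← Finset.sum_div]
    ring

open Filter Asymptotics Topology in
/-- Mixing a little of `q₁` into `q₀` destroys information, if `q₁` charges an atom that is missing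
in `q₀` although both its coordinates are present there. -/
theorem eventually_infoSum_add_smul_lt {q₀ q₁ : α × β → ℝ} (h₀ : ∀ a, 0 ≤ q₀ a)
    (h₁ : ∀ a, 0 ≤ q₁ a) (hX : supp (margFst q₁) ⊆ supp (margFst q₀)) {x : α} {y : β}
    (hy : 0 < margSnd q₀ y) (hxy₀ : q₀ (x, y) = 0) (hxy₁ : 0 < q₁ (x, y)) :
    ∀ᶠ δ : ℝ in 𝓝[>] 0, infoSum (fun a => q₀ a + δ * q₁ a) < infoSum q₀ + δ * infoSum q₁ := by
  have hs : 0 < ∑ b, margSnd q₀ b := sum_margSnd_pos h₀ hy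
  set c := q₁ (x, y)
  have bF := isBigO_sum_negMulLog_add_mul (margFst q₀) (margFst q₁) (margFst_nonneg h₀)
  have bS := isBigO_sum_negMulLog_add_mul (margSnd q₀) (margSnd q₁) (margSnd_nonneg h₀)
  have bJ := isBigO_sum_negMulLog_add_mul q₀ q₁ h₀
  have bT := isBigO_negMulLog_add_mul (∑ b, margSnd q₀ b) (∑ b, margSnd q₁ b) hs.le
  -- The first marginal gains no new support, hence no `δ log δ` term.
  have cF : (∑ i, if margFst q₀ i = 0 then margFst q₁ i else 0) = 0 := by
    refine Finset.sum_eq_zero fun i _ => ?_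
    split_ifs with h
    · by_contra h'
      have : i ∈ supp (margFst q₀) := hX (lt_of_le_of_ne (margFst_nonneg h₁ i) (Ne.symm h'))
      exact (ne_of_gt this) h
    · rfl
  -- An atom in a column missing from `q₀` is itself missing from `q₀`. The atom `(x, y)` is missing
  -- too, but its column is present, which gives the surplus `c`.
  have cJ : (∑ i, if margSnd q₀ i = 0 then margSnd q₁ i else 0) + c ≤
      ∑ i, if q₀ i = 0 then q₁ i else 0 := by
    classical
    have e1 : (∑ i, if margSnd q₀ i = 0 then margSnd q₁ i else 0)
        = ∑ a : α × β, if margSnd q₀ a.2 = 0 then q₁ a else 0 := by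
      rw [Fintype.sum_prod_type_right]
      refine Finset.sum_congr rfl fun b _ => ?_
      split_ifs with h <;> simp [margSnd]
    have e2 : c = ∑ a : α × β, if a = (x, y) then c else 0 := by simp
    rw [e1, e2, ← Finset.sum_add_distrib]
    refine Finset.sum_le_sum fun a _ => ?_
    by_cases ha : a = (x, y)
    · subst ha
      simp [hy.ne', hxy₀, c]
    · simp only [ha, if_false, add_zero]
      by_cases hb : margSnd q₀ a.2 = 0
      · have : q₀ a = 0 := by
          by_contra h
          exact (margSnd_pos h₀ (x := a.1) (y := a.2)
            (lt_of_le_of_ne (h₀ a) (Ne.symm h))).ne' hb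
        simp [hb, this]
      · simp only [hb, if_false]
        split_ifs
        · exact h₁ a
        · rfl
  rw [cF] at bF
  simp only [hs.ne', if_false] at bT
  have b := ((bF.add bS).sub bJ).sub bT
  -- `C` collects all linear terms, including `δ * infoSum q₁`; the logarithm eventually exceeds it.
  obtain ⟨C, hC⟩ := (b.sub ((isBigO_refl (fun δ : ℝ => δ) (𝓝[>] (0 : ℝ))).const_mul_left
      (infoSum q₁))).bound
  have hlog : ∀ᶠ δ : ℝ in 𝓝[>] 0, C < c * (-Real.log δ) := by
    have := (tendsto_neg_atBot_atTop.comp Real.tendsto_log_nhdsGT_zero).const_mul_atTop hxy₁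
    exact this.eventually_gt_atTop C
  filter_upwards [hC, hlog, self_mem_nhdsWithin,
    (eventually_lt_nhds (zero_lt_one (α := ℝ))).filter_mono nhdsWithin_le_nhds]
    with δ h1 h2 (h3 : 0 < δ) h4
  have eF : margFst (fun a => q₀ a + δ * q₁ a) = fun x => margFst q₀ x + δ * margFst q₁ x := by
    ext x; simp [margFst, Finset.mul_sum, Finset.sum_add_distrib]
  have eS : margSnd (fun a => q₀ a + δ * q₁ a) = fun x => margSnd q₀ x + δ * margSnd q₁ x := by
    ext x; simp [margSnd, Finset.mul_sum, Finset.sum_add_distrib]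
  rw [infoSum_eq (fun a => add_nonneg (h₀ a) (mul_nonneg h3.le (h₁ a))), infoSum_eq h₀, eF, eS]
  simp only [Finset.sum_add_distrib, ← Finset.mul_sum]
  have hn : 0 < Real.negMulLog δ := by
    rw [Real.negMulLog, neg_mul, neg_pos]
    exact mul_neg_of_pos_of_neg h3 (Real.log_neg h3 h4)
  have h5 := mul_le_mul_of_nonneg_right cJ hn.le
  rw [Real.norm_of_nonneg h3.le] at h1
  have h6 := (le_abs_self _).trans h1
  have h7 : C * δ < c * Real.negMulLog δ := by
    have := mul_lt_mul_of_pos_right h2 h3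
    rw [Real.negMulLog]; linarith
  linarith
end

/-! ### One-shot converse by change of measure. -/

theorem sum_rotate {α β γ R : Type*} [Fintype α] [Fintype β] [Fintype γ] [AddCommMonoid R]
    (F : α → β → γ → R) : ∑ a, ∑ b, ∑ c, F a b c = ∑ c, ∑ a, ∑ b, F a b c := by
  rw [Finset.sum_comm (s := (Finset.univ : Finset γ))]
  exact Finset.sum_congr rfl fun a _ => Finset.sum_comm

section
variable {𝒦 A B D M : Type*} [Fintype 𝒦] [Fintype A] [Fintype B] [Fintype D] [Fintype M]

/-- A prediction of Alice's output from the public information `(d, m)`, such that the likelihood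
ratio test for Bob producing the same output has bounded expectation when the parties' inputs are
independent given `d`. -/
theorem exists_prediction [Nonempty 𝒦] {γ : A → D → ℝ} {η : B → D → ℝ} {α : A → M → 𝒦 → ℝ}
    {β : B → M → 𝒦 → ℝ} (hγ : ∀ a d, 0 ≤ γ a d) (hη : ∀ b d, 0 ≤ η b d)
    (hα : ∀ a m u, 0 ≤ α a m u) (hβ : ∀ b m u, 0 ≤ β b m u)
    (hγη : ∑ a, ∑ b, ∑ d, γ a d * η b d ≤ 1)
    (hαβ : ∀ a b, ∑ m, ∑ u, ∑ v, α a m u * β b m v ≤ 1) :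
    ∃ Q : 𝒦 → D → M → ℝ, (∀ k d m, 1 / (2 * (Fintype.card 𝒦 : ℝ)) ≤ Q k d m) ∧
      (∀ d m, ∑ k, Q k d m ≤ 1) ∧
      ∑ a, ∑ b, ∑ d, ∑ m, ∑ u, γ a d * η b d * (α a m u * β b m u / Q u d m) ≤ 2 := by
  have hc : (0 : ℝ) < Fintype.card 𝒦 := by exact_mod_cast Fintype.card_pos
  set E : D → M → 𝒦 → ℝ := fun d m u => ∑ a, γ a d * α a m u with hE
  have hE0 : ∀ d m u, 0 ≤ E d m u := fun d m u =>
    Finset.sum_nonneg fun a _ => mul_nonneg (hγ a d) (hα a m u)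
  have hS0 : ∀ d m, 0 ≤ ∑ u, E d m u := fun d m => Finset.sum_nonneg fun u _ => hE0 d m u
  -- An equal mixture of this posterior and the uniform law. The uniform half keeps `Q` bounded
  -- below; halving the posterior costs the factor 2 in the final bound.
  set Q : 𝒦 → D → M → ℝ := fun k d m =>
    (1 / 2) * (E d m k / ∑ u, E d m u) + 1 / (2 * (Fintype.card 𝒦 : ℝ)) with hQ
  have hQ1 : ∀ k d m, 1 / (2 * (Fintype.card 𝒦 : ℝ)) ≤ Q k d m := fun k d m =>
    le_add_of_nonneg_left (mul_nonneg (by norm_num) (div_nonneg (hE0 _ _ _) (hS0 _ _)))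
  have hQ0 : ∀ k d m, 0 < Q k d m := fun k d m =>
    lt_of_lt_of_le (by positivity) (hQ1 k d m)
  have hEQ : ∀ d m u, E d m u / Q u d m ≤ 2 * ∑ u, E d m u := by
    intro d m u
    rw [div_le_iff₀ (hQ0 _ _ _)]
    rcases (hS0 d m).eq_or_lt with h | h
    · have h' := (Finset.sum_eq_zero_iff_of_nonneg (fun u _ => hE0 d m u)).1 h.symm u
        (Finset.mem_univ u)
      rw [h', ← h]; simp
    · have : E d m u = 2 * (∑ u, E d m u) * ((1 / 2) * (E d m u / ∑ u, E d m u)) := by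
        field_simp
      calc E d m u = _ := this
        _ ≤ _ := by
          refine mul_le_mul_of_nonneg_left ?_ (by positivity)
          simp only [hQ]
          exact le_add_of_nonneg_right (by positivity)
  refine ⟨Q, hQ1, fun d m => ?_, ?_⟩
  · have h1 : (∑ k, E d m k) / ∑ u, E d m u ≤ 1 := div_self_le_one _
    simp only [hQ, Finset.sum_add_distrib, ← Finset.mul_sum, ← Finset.sum_div, Finset.sum_const,
      Finset.card_univ, nsmul_eq_mul]
    have h2 : (Fintype.card 𝒦 : ℝ) * 1 / (2 * (Fintype.card 𝒦 : ℝ)) = 1 / 2 := by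
      field_simp
    rw [h2]
    linarith
  · calc ∑ a, ∑ b, ∑ d, ∑ m, ∑ u, γ a d * η b d * (α a m u * β b m u / Q u d m)
        = ∑ d, ∑ m, ∑ u, ∑ a, ∑ b, γ a d * η b d * (α a m u * β b m u / Q u d m) := by
          rw [sum_rotate]
          refine Finset.sum_congr rfl fun d _ => ?_
          rw [sum_rotate]
          refine Finset.sum_congr rfl fun m _ => ?_
          rw [sum_rotate]
      _ = ∑ d, ∑ m, ∑ u, (∑ b, η b d * β b m u) * (E d m u / Q u d m) := by
          refine Finset.sum_congr rfl fun d _ => Finset.sum_congr rfl fun m _ =>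
            Finset.sum_congr rfl fun u _ => ?_
          rw [hE, Finset.sum_div, Finset.sum_mul_sum, Finset.sum_comm]
          refine Finset.sum_congr rfl fun b _ => Finset.sum_congr rfl fun a _ => ?_
          ring
      _ ≤ ∑ d, ∑ m, ∑ u, (∑ b, η b d * β b m u) * (2 * ∑ u, E d m u) := by
          gcongr with d _ m _ u _
          · exact Finset.sum_nonneg fun b _ => mul_nonneg (hη _ _) (hβ _ _ _)
          · exact hEQ d m u
      _ = 2 * ∑ d, ∑ m, ∑ u, ∑ v, ∑ a, ∑ b, γ a d * η b d * (α a m v * β b m u) := by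
          simp only [hE, Finset.mul_sum, Finset.sum_mul]
          refine Finset.sum_congr rfl fun d _ => Finset.sum_congr rfl fun m _ =>
            Finset.sum_congr rfl fun u _ => Finset.sum_congr rfl fun v _ =>
            Finset.sum_congr rfl fun a _ => Finset.sum_congr rfl fun b _ => ?_
          ring
      _ = 2 * ∑ d, ∑ m, ∑ u, ∑ v, ∑ a, ∑ b, γ a d * η b d * (α a m u * β b m v) := by
          congr 1
          refine Finset.sum_congr rfl fun d _ => Finset.sum_congr rfl fun m _ => ?_
          rw [Finset.sum_comm]
      _ = 2 * ∑ a, ∑ b, ∑ d, γ a d * η b d * ∑ m, ∑ u, ∑ v, α a m u * β b m v := by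
          simp only [Finset.mul_sum]
          symm
          rw [sum_rotate]
          refine Finset.sum_congr rfl fun d _ => ?_
          rw [sum_rotate]
          refine Finset.sum_congr rfl fun m _ => ?_
          rw [sum_rotate]
          refine Finset.sum_congr rfl fun u _ => ?_
          rw [sum_rotate]
      _ ≤ 2 * ∑ a, ∑ b, ∑ d, γ a d * η b d * 1 := by
          gcongr with a _ b _ d _
          · exact mul_nonneg (hγ _ _) (hη _ _)
          · exact hαβ a b
      _ ≤ 2 := by simp only [mul_one]; linarith

/-- A Donsker-Varadhan bound for the event that both outputs agree. -/
theorem sum_agree_le [DecidableEq 𝒦] {γ : A → D → ℝ} {η : B → D → ℝ}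
    {α : A → M → 𝒦 → ℝ} {β : B → M → 𝒦 → ℝ} {q : A → B → D → ℝ} {Q : 𝒦 → D → M → ℝ}
    (hγ : ∀ a d, 0 ≤ γ a d) (hη : ∀ b d, 0 ≤ η b d)
    (hα : ∀ a m u, 0 ≤ α a m u) (hβ : ∀ b m u, 0 ≤ β b m u) (hq : ∀ a b d, 0 ≤ q a b d)
    (hQ : ∀ k d m, 0 < Q k d m)
    (hγη : ∑ a, ∑ b, ∑ d, γ a d * η b d ≤ 1)
    (hαβ : ∀ a b, ∑ m, ∑ u, ∑ v, α a m u * β b m v ≤ 1)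
    (hq1 : ∑ a, ∑ b, ∑ d, q a b d = 1)
    (hqαβ : ∀ a b d, q a b d * ∑ m, ∑ u, ∑ v, α a m u * β b m v = q a b d)
    (hac : ∀ a b d, 0 < q a b d → 0 < γ a d * η b d)
    (hQ2 : ∑ a, ∑ b, ∑ d, ∑ m, ∑ u, γ a d * η b d * (α a m u * β b m u / Q u d m) ≤ 2) :
    ∑ a, ∑ b, ∑ d, q a b d * ∑ m, ∑ u, ∑ v, α a m u * β b m v *
        (if u = v then -Real.log (Q u d m) else 0) ≤
      ∑ a, ∑ b, ∑ d, q a b d * Real.log (q a b d / (γ a d * η b d)) + Real.log 3 := by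
  -- This is `log s ≤ s - 1` at `s = r t / (3 q)`, where `t` is `1 / Q` on agreement and `1`
  -- otherwise. The 3 bounds the mean of `t` under the conditionally independent source: 1 from the
  -- constant part and 2 from `hQ2`.
  have key : ∀ a b d m u v, q a b d * (α a m u * β b m v *
      (if u = v then -Real.log (Q u d m) else 0)) ≤
      q a b d * (α a m u * β b m v) * (Real.log (q a b d / (γ a d * η b d)) + Real.log 3 - 1)
      + γ a d * η b d * (α a m u * β b m v + if u = v then α a m u * β b m v / Q u d m else 0)
        / 3 := by
    intro a b d m u v
    set w := α a m u * β b m v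
    have hw : 0 ≤ w := mul_nonneg (hα _ _ _) (hβ _ _ _)
    set r := γ a d * η b d with hr
    have hr0 : 0 ≤ r := mul_nonneg (hγ _ _) (hη _ _)
    have hQ' := hQ u d m
    rcases (hq a b d).eq_or_lt with h | h
    · rw [← h]; simp only [zero_mul, zero_add]
      split_ifs <;> positivity
    have hrp := hac a b d h
    rw [← hr] at hrp
    set t : ℝ := if u = v then 1 / Q u d m else 1 with ht
    have htp : 0 < t := by rw [ht]; split_ifs <;> positivity
    have hlt : (if u = v then -Real.log (Q u d m) else 0) = Real.log t := by
      rw [ht]; split_ifs <;> simp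
    have hle : w * t ≤ w + if u = v then w / Q u d m else 0 := by
      rw [ht]
      split_ifs
      · rw [mul_one_div]; linarith
      · simp
    rw [hlt]
    have h1 := Real.log_le_sub_one_of_pos (x := r * t / (3 * q a b d)) (by positivity)
    rw [Real.log_div (by positivity) (by positivity), Real.log_mul hrp.ne' htp.ne',
      Real.log_mul (by norm_num) h.ne'] at h1
    rw [Real.log_div h.ne' hrp.ne']
    have h2 := mul_le_mul_of_nonneg_left h1 (mul_nonneg h.le hw)
    have h3 : q a b d * w * (r * t / (3 * q a b d)) = r * (w * t) / 3 := by field_simp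
    have h4 := mul_le_mul_of_nonneg_left hle hr0
    linarith
  have hR : ∑ a, ∑ b, ∑ d, ∑ m, ∑ u, ∑ v, γ a d * η b d *
      (α a m u * β b m v + if u = v then α a m u * β b m v / Q u d m else 0) ≤ 3 := by
    simp only [mul_add, Finset.sum_add_distrib, mul_ite, mul_zero, Finset.sum_ite_eq,
      Finset.mem_univ, if_true]
    have : ∑ a, ∑ b, ∑ d, ∑ m, ∑ u, ∑ v, γ a d * η b d * (α a m u * β b m v) ≤ 1 := by
      refine le_trans ?_ hγη
      simp only [← Finset.mul_sum]
      refine Finset.sum_le_sum fun a _ => Finset.sum_le_sum fun b _ => Finset.sum_le_sum fun d _ =>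
        mul_le_of_le_one_right (mul_nonneg (hγ _ _) (hη _ _)) ?_
      simpa only [Finset.mul_sum] using hαβ a b
    linarith
  have hL : ∑ a, ∑ b, ∑ d, ∑ m, ∑ u, ∑ v, q a b d * (α a m u * β b m v) *
      (Real.log (q a b d / (γ a d * η b d)) + Real.log 3 - 1) =
      ∑ a, ∑ b, ∑ d, q a b d * Real.log (q a b d / (γ a d * η b d)) + (Real.log 3 - 1) := by
    have : ∀ a b d, ∑ m, ∑ u, ∑ v, q a b d * (α a m u * β b m v) *
        (Real.log (q a b d / (γ a d * η b d)) + Real.log 3 - 1) =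
        q a b d * Real.log (q a b d / (γ a d * η b d)) + q a b d * (Real.log 3 - 1) := by
      intro a b d
      rw [← mul_add, ← add_sub_assoc]
      generalize Real.log (q a b d / (γ a d * η b d)) + Real.log 3 - 1 = L
      conv_rhs => rw [← hqαβ a b d]
      simp only [Finset.mul_sum, Finset.sum_mul]
    simp only [this]
    simp only [Finset.sum_add_distrib, ← Finset.sum_mul, hq1, one_mul]
  calc _ ≤ ∑ a, ∑ b, ∑ d, ∑ m, ∑ u, ∑ v, (q a b d * (α a m u * β b m v) *
        (Real.log (q a b d / (γ a d * η b d)) + Real.log 3 - 1) + γ a d * η b d *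
        (α a m u * β b m v + if u = v then α a m u * β b m v / Q u d m else 0) / 3) := by
        simp only [Finset.mul_sum]
        exact Finset.sum_le_sum fun a _ => Finset.sum_le_sum fun b _ =>
          Finset.sum_le_sum fun d _ => Finset.sum_le_sum fun m _ => Finset.sum_le_sum fun u _ =>
          Finset.sum_le_sum fun v _ => key a b d m u v
    _ ≤ _ := by
      simp only [Finset.sum_add_distrib, ← Finset.sum_div]
      linarith
end

/-- Gibbs' inequality for a conditional distribution. -/
theorem margSnd_mul_shannonEntropy_condFst_le {α β : Type*} [Fintype α] {r : α × β → ℝ}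
    (hr : ∀ a, 0 ≤ r a) (b : β) {G : α → ℝ} (hG : ∀ a, 0 < G a) (hG1 : ∑ a, G a ≤ 1) :
    margSnd r b * shannonEntropy (condFst r b) * Real.log 2 ≤
      ∑ a, r (a, b) * -Real.log (G a) := by
  have hs := margSnd_nonneg hr b
  have h2 : Real.log 2 ≠ 0 := (Real.log_pos (by norm_num)).ne'
  rcases hs.eq_or_lt with h | h
  · have : ∀ a, r (a, b) = 0 := fun a =>
      (Finset.sum_eq_zero_iff_of_nonneg (fun _ _ => hr _)).1 h.symm a (Finset.mem_univ a)
    simp [← h, this]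
  have key : ∀ a, margSnd r b * Real.negMulLog (condFst r b a) ≤
      r (a, b) * -Real.log (G a) + (margSnd r b * G a - r (a, b)) := by
    intro a
    rw [condFst]
    rcases (hr (a, b)).eq_or_lt with h' | h'
    · simp [← h', (mul_pos h (hG a)).le]
    · have h1 := Real.log_le_sub_one_of_pos (x := margSnd r b * G a / r (a, b))
        (div_pos (mul_pos h (hG a)) h')
      rw [Real.log_div (mul_pos h (hG a)).ne' h'.ne', Real.log_mul h.ne' (hG a).ne'] at h1
      rw [Real.negMulLog, Real.log_div h'.ne' h.ne']
      have h3 := mul_le_mul_of_nonneg_left h1 h'.le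
      have h4 : r (a, b) * (margSnd r b * G a / r (a, b) - 1) = margSnd r b * G a - r (a, b) := by
        field_simp
      have h5 : margSnd r b * (-(r (a, b) / margSnd r b) *
          (Real.log (r (a, b)) - Real.log (margSnd r b))) =
          - (r (a, b) * (Real.log (r (a, b)) - Real.log (margSnd r b))) := by field_simp
      rw [h5]
      linarith
  have h1 := Finset.sum_le_sum fun a (_ : a ∈ Finset.univ) => key a
  rw [Finset.sum_add_distrib, Finset.sum_sub_distrib, ← Finset.mul_sum, ← Finset.mul_sum] at h1
  have h3 : ∑ a, r (a, b) = margSnd r b := rfl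
  rw [h3] at h1
  rw [shannonEntropy, ← Finset.sum_div, mul_assoc, div_mul_cancel₀ _ h2]
  have := mul_le_mul_of_nonneg_left hG1 hs
  linarith

/-- Given `(c, m)`, the variable `d` is fresh noise. Gibbs' inequality therefore holds against `Q ·
d m` for each `d` separately, and averaging over `W c` keeps it. -/
theorem condEntropy_mul_log_two_le {𝒦 C D M : Type*} [Fintype 𝒦] [Fintype C] [Fintype D]
    [Fintype M] {r : 𝒦 × C × M → ℝ} (hr : ∀ t, 0 ≤ r t) {W : C → D → ℝ} (hW : ∀ c d, 0 ≤ W c d)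
    (hW1 : ∀ c, ∑ d, W c d = 1) {Q : 𝒦 → D → M → ℝ} (hQ0 : ∀ k d m, 0 < Q k d m)
    (hQ1 : ∀ d m, ∑ k, Q k d m ≤ 1) :
    condEntropy r * Real.log 2 ≤
      ∑ t, r t * ∑ d, W t.2.1 d * -Real.log (Q t.1 d t.2.2) := by
  rw [Fintype.sum_prod_type_right, condEntropy, Finset.sum_mul]
  refine Finset.sum_le_sum fun e _ => ?_
  calc margSnd r e * shannonEntropy (condFst r e) * Real.log 2
      = ∑ d, W e.1 d * (margSnd r e * shannonEntropy (condFst r e) * Real.log 2) := by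
        rw [← Finset.sum_mul, hW1, one_mul]
    _ ≤ ∑ d, W e.1 d * ∑ k, r (k, e) * -Real.log (Q k d e.2) := by
        refine Finset.sum_le_sum fun d _ => mul_le_mul_of_nonneg_left ?_ (hW _ _)
        exact margSnd_mul_shannonEntropy_condFst_le hr e (fun k => hQ0 k d e.2) (hQ1 d e.2)
    _ = _ := by
        simp only [Finset.mul_sum]
        rw [Finset.sum_comm]
        refine Finset.sum_congr rfl fun k _ => Finset.sum_congr rfl fun d _ => ?_
        ring

/-! ### Expectations under laws of finitely valued variables. -/

section
variable {Ω S R : Type*} [MeasurableSpace Ω] {μ : Measure Ω} [IsProbabilityMeasure μ]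
  [Fintype S]

theorem measureReal_eq_sum_law {U : Ω → S} (hU : ∀ s, MeasurableSet {ω | U ω = s})
    (P : S → Prop) [DecidablePred P] : μ.real {ω | P (U ω)} = ∑ s, law μ U s * if P s then 1 else 0 := by
  have h : {ω | P (U ω)} = ⋃ s ∈ Finset.univ.filter P, {ω | U ω = s} := by
    ext ω; simp
  rw [h, measureReal_biUnion_finset ?_ (fun s _ => hU s), Finset.sum_filter]
  · exact Finset.sum_congr rfl fun s _ => by split_ifs <;> simp [law]
  · intro s _ t _ hst
    exact Set.disjoint_left.2 fun ω h1 h2 => hst (h1.symm.trans h2)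

theorem sum_law {U : Ω → S} (hU : ∀ s, MeasurableSet {ω | U ω = s}) : ∑ s, law μ U s = 1 := by
  have := measureReal_eq_sum_law (μ := μ) hU (fun _ => True)
  simpa using this.symm

theorem sum_law_comp_mul [Fintype R] {U : Ω → S} (hU : ∀ s, MeasurableSet {ω | U ω = s})
    (φ : S → R) (F : R → ℝ) :
    ∑ r, law μ (fun ω => φ (U ω)) r * F r = ∑ s, law μ U s * F (φ s) := by
  classical
  have : ∀ r, law μ (fun ω => φ (U ω)) r = ∑ s, law μ U s * if φ s = r then 1 else 0 := fun r =>
    measureReal_eq_sum_law hU (fun s => φ s = r)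
  simp only [this, Finset.sum_mul]
  rw [Finset.sum_comm]
  refine Finset.sum_congr rfl fun s _ => ?_
  simp
end

/-- One-shot converse for key agreement: the eavesdropper's equivocation about the key is
controlled by the divergence between the source, degraded by the channel `W`, and a source with
conditionally independent inputs. -/
theorem condEntropy_le_of_factorization {Ω 𝒦 A B C D M : Type*} [MeasurableSpace Ω]
    {μ : Measure Ω} [IsProbabilityMeasure μ] [Fintype 𝒦] [Fintype A] [Fintype B] [Fintype C]
    [Fintype D] [Fintype M]
    {K : Ω → 𝒦} {X : Ω → A} {Y : Ω → B} {Z : Ω → C} {V : Ω → M} {f g : Ω → 𝒦}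
    (hmeas : ∀ t, MeasurableSet {ω | (K ω, X ω, Y ω, Z ω, V ω, f ω, g ω) = t})
    {p : A → B → C → ℝ} {α : A → M → 𝒦 → ℝ} {β : B → M → 𝒦 → ℝ} {W : C → D → ℝ}
    {γ : A → D → ℝ} {η : B → D → ℝ}
    (hγ : ∀ a d, 0 ≤ γ a d) (hη : ∀ b d, 0 ≤ η b d)
    (hα : ∀ a m u, 0 ≤ α a m u) (hβ : ∀ b m u, 0 ≤ β b m u)
    (hW : ∀ c d, 0 ≤ W c d) (hW1 : ∀ c, ∑ d, W c d = 1)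
    (hγη : ∑ a, ∑ b, ∑ d, γ a d * η b d ≤ 1)
    (hαβ : ∀ a b, ∑ m, ∑ u, ∑ v, α a m u * β b m v ≤ 1)
    (hp : ∀ a b c, law μ (fun ω => (X ω, Y ω, Z ω)) (a, b, c) = p a b c)
    (hfac : ∀ a b c m u v, law μ (fun ω => (X ω, Y ω, Z ω, V ω, f ω, g ω)) (a, b, c, m, u, v)
      = p a b c * (α a m u * β b m v))
    (hac : ∀ a b d, 0 < ∑ c, p a b c * W c d → 0 < γ a d * η b d) :
    condEntropy (law μ (fun ω => (K ω, (Z ω, V ω)))) * Real.log 2 ≤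
      ∑ a, ∑ b, ∑ d, (∑ c, p a b c * W c d) *
        Real.log ((∑ c, p a b c * W c d) / (γ a d * η b d)) + Real.log 3
      + (1 - μ.real {ω | f ω = K ω ∧ g ω = K ω}) * Real.log (2 * Fintype.card 𝒦) := by
  classical
  have : Nonempty Ω := μ.nonempty_of_neZero
  have : Nonempty 𝒦 := Nonempty.map K this
  have hc : (0 : ℝ) < Fintype.card 𝒦 := by exact_mod_cast Fintype.card_pos
  obtain ⟨Q, hQl, hQ1, hQ2⟩ := exists_prediction hγ hη hα hβ hγη hαβ
  have hQ0 : ∀ k d m, 0 < Q k d m := fun k d m => lt_of_lt_of_le (by positivity) (hQl k d m)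
  have hQle : ∀ k d m, Q k d m ≤ 1 := fun k d m =>
    (Finset.single_le_sum (f := fun k => Q k d m) (fun k _ => (hQ0 k d m).le)
      (Finset.mem_univ k)).trans (hQ1 d m)
  have hlog0 : ∀ k d m, 0 ≤ -Real.log (Q k d m) := fun k d m =>
    neg_nonneg.2 (Real.log_nonpos (hQ0 k d m).le (hQle k d m))
  have hlogle : ∀ k d m, -Real.log (Q k d m) ≤ Real.log (2 * Fintype.card 𝒦) := fun k d m => by
    rw [← Real.log_inv]
    refine Real.log_le_log (inv_pos.2 (hQ0 k d m)) ?_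
    rw [inv_le_comm₀ (hQ0 k d m) (by positivity)]
    simpa using hQl k d m
  set T : Ω → 𝒦 × A × B × C × M × 𝒦 × 𝒦 := fun ω => (K ω, X ω, Y ω, Z ω, V ω, f ω, g ω) with hT
  have hp0 : ∀ a b c, 0 ≤ p a b c := fun a b c => by rw [← hp]; exact measureReal_nonneg
  have step1 : condEntropy (law μ (fun ω => (K ω, (Z ω, V ω)))) * Real.log 2 ≤
      ∑ t, law μ T t * ∑ d, W t.2.2.2.1 d * -Real.log (Q t.1 d t.2.2.2.2.1) := by
    have e := sum_law_comp_mul (μ := μ) hmeas (fun t => (t.1, (t.2.2.2.1, t.2.2.2.2.1)))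
      (fun r : 𝒦 × C × M => ∑ d, W r.2.1 d * -Real.log (Q r.1 d r.2.2))
    rw [← e]
    exact condEntropy_mul_log_two_le (fun _ => measureReal_nonneg) hW hW1 hQ0 hQ1
  -- Where both outputs equal `K`, the key may be replaced by Alice's output. Elsewhere the loss is
  -- at most the uniform bound `hlogle`.
  have step2 : ∑ t, law μ T t * ∑ d, W t.2.2.2.1 d * -Real.log (Q t.1 d t.2.2.2.2.1) ≤
      ∑ t, law μ T t * ∑ d, W t.2.2.2.1 d *
        (if t.2.2.2.2.2.1 = t.2.2.2.2.2.2 then -Real.log (Q t.2.2.2.2.2.1 d t.2.2.2.2.1) else 0)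
      + (1 - μ.real {ω | f ω = K ω ∧ g ω = K ω}) * Real.log (2 * Fintype.card 𝒦) := by
    have e := measureReal_eq_sum_law (μ := μ) hmeas
      (fun t => t.2.2.2.2.2.1 = t.1 ∧ t.2.2.2.2.2.2 = t.1)
    have e' : 1 - μ.real {ω | f ω = K ω ∧ g ω = K ω} = ∑ t, law μ T t *
        (1 - if t.2.2.2.2.2.1 = t.1 ∧ t.2.2.2.2.2.2 = t.1 then 1 else 0) := by
      simp only [mul_sub, mul_one, Finset.sum_sub_distrib]
      rw [sum_law hmeas]
      exact congrArg _ e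
    rw [e', Finset.sum_mul, ← Finset.sum_add_distrib]
    refine Finset.sum_le_sum fun t _ => ?_
    have h1 : ∑ d, W t.2.2.2.1 d * -Real.log (Q t.1 d t.2.2.2.2.1) ≤
        ∑ d, W t.2.2.2.1 d * (if t.2.2.2.2.2.1 = t.2.2.2.2.2.2 then
          -Real.log (Q t.2.2.2.2.2.1 d t.2.2.2.2.1) else 0)
        + (1 - if t.2.2.2.2.2.1 = t.1 ∧ t.2.2.2.2.2.2 = t.1 then 1 else 0) *
          Real.log (2 * Fintype.card 𝒦) := by
      by_cases hgood : t.2.2.2.2.2.1 = t.1 ∧ t.2.2.2.2.2.2 = t.1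
      · simp only [if_pos hgood, sub_self, zero_mul, add_zero,
          if_pos (hgood.1.trans hgood.2.symm)]
        rw [hgood.1]
      · rw [if_neg hgood, sub_zero, one_mul]
        have h2 : ∑ d, W t.2.2.2.1 d * -Real.log (Q t.1 d t.2.2.2.2.1) ≤
            ∑ d, W t.2.2.2.1 d * Real.log (2 * Fintype.card 𝒦) := by
          gcongr with d _
          · exact hW _ _
          · exact hlogle _ _ _
        rw [← Finset.sum_mul, hW1, one_mul] at h2
        refine h2.trans (le_add_of_nonneg_left (Finset.sum_nonneg fun d _ =>
          mul_nonneg (hW _ _) ?_))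
        split_ifs
        · exact hlog0 _ _ _
        · exact le_rfl
    have h3 := mul_le_mul_of_nonneg_left h1 (measureReal_nonneg : 0 ≤ law μ T t)
    rw [mul_add, ← mul_assoc] at h3
    exact h3
  have step3 : ∑ t, law μ T t * ∑ d, W t.2.2.2.1 d *
      (if t.2.2.2.2.2.1 = t.2.2.2.2.2.2 then -Real.log (Q t.2.2.2.2.2.1 d t.2.2.2.2.1) else 0)
      = ∑ a, ∑ b, ∑ d, (∑ c, p a b c * W c d) * ∑ m, ∑ u, ∑ v, α a m u * β b m v *
        (if u = v then -Real.log (Q u d m) else 0) := by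
    have e := sum_law_comp_mul (μ := μ) hmeas (fun t => t.2)
      (fun t => ∑ d, W t.2.2.1 d *
      (if t.2.2.2.2.1 = t.2.2.2.2.2 then -Real.log (Q t.2.2.2.2.1 d t.2.2.2.1) else 0))
    rw [← e]
    simp only [Fintype.sum_prod_type, hfac]
    refine Finset.sum_congr rfl fun a _ => Finset.sum_congr rfl fun b _ => ?_
    simp only [Finset.mul_sum, Finset.sum_mul]
    symm
    calc _ = ∑ d, ∑ c, ∑ m, ∑ u, ∑ v, p a b c * W c d * (α a m u * β b m v *
          (if u = v then -Real.log (Q u d m) else 0)) := by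
          refine Finset.sum_congr rfl fun d _ => ?_
          symm
          rw [Finset.sum_comm]
          refine Finset.sum_congr rfl fun m _ => ?_
          rw [Finset.sum_comm]
          refine Finset.sum_congr rfl fun u _ => ?_
          rw [Finset.sum_comm]
      _ = _ := by
          rw [Finset.sum_comm]
          refine Finset.sum_congr rfl fun c _ => ?_
          rw [Finset.sum_comm]
          refine Finset.sum_congr rfl fun m _ => ?_
          rw [Finset.sum_comm]
          refine Finset.sum_congr rfl fun u _ => ?_
          rw [Finset.sum_comm]
          refine Finset.sum_congr rfl fun v _ => Finset.sum_congr rfl fun d _ => ?_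
          ring
  -- Both sides are the probability of the source value `(a, b, c)`, computed from the joint law of
  -- source, transcript and outputs and from the source law.
  have hpαβ : ∀ a b c, p a b c * ∑ m, ∑ u, ∑ v, α a m u * β b m v = p a b c := by
    intro a b c
    have h1 := sum_law_comp_mul (μ := μ) hmeas (fun t => t.2)
      (fun s => if (s.1, s.2.1, s.2.2.1) = (a, b, c) then 1 else 0)
    have h2 := sum_law_comp_mul (μ := μ) hmeas (fun t => (t.2.1, t.2.2.1, t.2.2.2.1))
      (fun s => if s = (a, b, c) then 1 else 0)
    have h3 := h1.trans h2.symm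
    simp only [Fintype.sum_prod_type, hfac, hp, Prod.mk.injEq, mul_ite, mul_one, mul_zero,
      ite_and] at h3
    simp only [Finset.mul_sum]
    simpa using h3
  have hp1 : ∑ a, ∑ b, ∑ c, p a b c = 1 := by
    have h2 := sum_law_comp_mul (μ := μ) hmeas (fun t => (t.2.1, t.2.2.1, t.2.2.2.1))
      (fun _ => 1)
    simp only [mul_one] at h2
    rw [sum_law hmeas] at h2
    simpa only [Fintype.sum_prod_type, hp] using h2
  have step4 := sum_agree_le (q := fun a b d => ∑ c, p a b c * W c d) hγ hη hα hβ
    (fun a b d => Finset.sum_nonneg fun c _ => mul_nonneg (hp0 a b c) (hW c d)) hQ0 hγη hαβ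
    (by
      rw [← hp1]
      refine Finset.sum_congr rfl fun a _ => Finset.sum_congr rfl fun b _ => ?_
      rw [Finset.sum_comm]
      simp only [← Finset.mul_sum, hW1, mul_one])
    (fun a b d => by
      rw [Finset.sum_mul]
      refine Finset.sum_congr rfl fun c _ => ?_
      rw [mul_right_comm, hpαβ]) hac hQ2
  linarith

/-! ### Tensorization over the `n` copies. -/

section
variable {ι X Y D : Type*} [Fintype ι] [DecidableEq ι] [Fintype X] [Fintype Y] [Fintype D]

theorem sum_prod_three (F : ι → X → Y → D → ℝ) :
    ∑ a : ι → X, ∑ b : ι → Y, ∑ d : ι → D, ∏ i, F i (a i) (b i) (d i) =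
      ∏ i, ∑ x, ∑ y, ∑ j, F i x y j := by
  classical
  rw [Fintype.prod_sum]
  refine Finset.sum_congr rfl fun a _ => ?_
  rw [Fintype.prod_sum]
  refine Finset.sum_congr rfl fun b _ => ?_
  rw [Fintype.prod_sum]

/-- Additivity of the relative entropy for product distributions. -/
theorem sum_prod_mul_log_prod {q r : X → Y → D → ℝ} (hq : ∀ x y j, 0 ≤ q x y j)
    (hr : ∀ x y j, 0 < q x y j → 0 < r x y j) (hq1 : ∑ x, ∑ y, ∑ j, q x y j = 1) :
    ∑ a : ι → X, ∑ b : ι → Y, ∑ d : ι → D, (∏ i, q (a i) (b i) (d i)) *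
        Real.log ((∏ i, q (a i) (b i) (d i)) / ∏ i, r (a i) (b i) (d i)) =
      Fintype.card ι * ∑ x, ∑ y, ∑ j, q x y j * Real.log (q x y j / r x y j) := by
  classical
  -- The logarithm of the product is a sum over coordinates `k`; in the `k`-th summand only factor
  -- `k` carries a logarithm, so the sum over sequences factorizes.
  have key : ∀ (a : ι → X) (b : ι → Y) (d : ι → D), (∏ i, q (a i) (b i) (d i)) *
      Real.log ((∏ i, q (a i) (b i) (d i)) / ∏ i, r (a i) (b i) (d i)) =
      ∑ k, ∏ i, (q (a i) (b i) (d i) *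
        if i = k then Real.log (q (a i) (b i) (d i) / r (a i) (b i) (d i)) else 1) := by
    intro a b d
    simp only [Finset.prod_mul_distrib, Finset.prod_ite_eq', Finset.mem_univ, if_true,
      ← Finset.mul_sum]
    by_cases h : ∃ i, q (a i) (b i) (d i) = 0
    · obtain ⟨i, hi⟩ := h
      rw [Finset.prod_eq_zero (Finset.mem_univ i) hi, zero_mul, zero_mul]
    · push Not at h
      rw [← Finset.prod_div_distrib, Real.log_prod]
      intro i _
      have h1 := lt_of_le_of_ne (hq (a i) (b i) (d i)) (h i).symm
      exact (div_pos h1 (hr _ _ _ h1)).ne'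
  simp only [key]
  calc _ = ∑ k : ι, ∑ a : ι → X, ∑ b : ι → Y, ∑ d : ι → D, ∏ i, (q (a i) (b i) (d i) *
        if i = k then Real.log (q (a i) (b i) (d i) / r (a i) (b i) (d i)) else 1) := by
        symm
        rw [Finset.sum_comm]
        refine Finset.sum_congr rfl fun a _ => ?_
        rw [Finset.sum_comm]
        refine Finset.sum_congr rfl fun b _ => ?_
        rw [Finset.sum_comm]
    _ = ∑ k : ι, ∏ i : ι, if i = k then
          ∑ x, ∑ y, ∑ j, q x y j * Real.log (q x y j / r x y j) else 1 := by
        refine Finset.sum_congr rfl fun k _ => ?_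
        rw [sum_prod_three (fun i x y j => q x y j *
          if i = k then Real.log (q x y j / r x y j) else 1)]
        refine Finset.prod_congr rfl fun i _ => ?_
        split_ifs
        · rfl
        · simpa only [mul_one] using hq1
    _ = _ := by simp
end

/-! ### Degrading Eve's variable by a channel. -/

section
variable {𝒳 𝒴 𝒵 𝒥 : Type*} [Fintype 𝒳] [Fintype 𝒴] [Fintype 𝒵] [Fintype 𝒥]

/-- The joint (unnormalized) distribution of `X`, `Y` on the event that the channel `W` maps `Z`
to `j`. -/
noncomputable def degrade {𝒳 𝒴 𝒵 𝒥 : Type*} [Fintype 𝒵] (p : 𝒳 × 𝒴 × 𝒵 → ℝ) (W : 𝒵 → 𝒥 → ℝ)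
    (j : 𝒥) (a : 𝒳 × 𝒴) : ℝ :=
  ∑ z, p (a.1, a.2, z) * W z j

theorem degrade_nonneg {𝒳 𝒴 𝒵 𝒥 : Type*} [Fintype 𝒵] {p : 𝒳 × 𝒴 × 𝒵 → ℝ}
    (hp : ∀ a, 0 ≤ p a) {W : 𝒵 → 𝒥 → ℝ} (hW : ∀ z j, 0 ≤ W z j) (j : 𝒥) (a : 𝒳 × 𝒴) :
    0 ≤ degrade p W j a :=
  Finset.sum_nonneg fun _ _ => mul_nonneg (hp _) (hW _ _)

theorem sum_degrade {p : 𝒳 × 𝒴 × 𝒵 → ℝ} {W : 𝒵 → 𝒥 → ℝ} (hW1 : ∀ z, ∑ j, W z j = 1) :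
    ∑ x, ∑ y, ∑ j, degrade p W j (x, y) = ∑ a, p a := by
  simp only [Fintype.sum_prod_type, degrade]
  refine Finset.sum_congr rfl fun x _ => Finset.sum_congr rfl fun y _ => ?_
  rw [Finset.sum_comm]
  simp only [← Finset.mul_sum, hW1, mul_one]

theorem sum_infoSum_degrade (p : 𝒳 × 𝒴 × 𝒵 → ℝ) (W : 𝒵 → 𝒥 → ℝ) :
    ∑ j, infoSum (degrade p W j) = ∑ x, ∑ y, ∑ j, degrade p W j (x, y) *
      Real.log (degrade p W j (x, y) / (margFst (degrade p W j) x /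
        (∑ b, margSnd (degrade p W j) b) * margSnd (degrade p W j) y)) := by
  simp only [infoSum]
  rw [← sum_rotate]

/-- Each slice `j` keeps its mass when its marginals are made independent; a slice of mass zero
gives `0` by division by zero. -/
theorem sum_condIndep_le_one {p : 𝒳 × 𝒴 × 𝒵 → ℝ} (hp : ∀ a, 0 ≤ p a) (hp1 : ∑ a, p a = 1)
    {W : 𝒵 → 𝒥 → ℝ} (hW : ∀ z j, 0 ≤ W z j) (hW1 : ∀ z, ∑ j, W z j = 1) :
    ∑ x, ∑ y, ∑ j, margFst (degrade p W j) x /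
        (∑ b, margSnd (degrade p W j) b) * margSnd (degrade p W j) y ≤ 1 := by
  rw [← hp1, ← sum_degrade (p := p) hW1, sum_rotate,
    sum_rotate (fun x y j => degrade p W j (x, y))]
  refine Finset.sum_le_sum fun j _ => ?_
  rw [← Finset.sum_mul_sum, ← Finset.sum_div]
  have h1 : ∑ x, margFst (degrade p W j) x = ∑ x, ∑ y, degrade p W j (x, y) := rfl
  have h2 : ∑ y, margSnd (degrade p W j) y = ∑ x, ∑ y, degrade p W j (x, y) := Finset.sum_comm
  rw [h1, h2]
  exact mul_le_of_le_one_left (Finset.sum_nonneg fun x _ => Finset.sum_nonneg fun y _ =>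
    degrade_nonneg hp hW j _) (div_self_le_one _)
end

/-! ### Rectangle structure of public discussion. -/

section
variable {𝒳 𝒴 𝒵 : Type*} {p : 𝒳 × 𝒴 × 𝒵 → ℝ} {n : ℕ}

/-- Whether message `i` fits the transcript `m` is decided by separate conditions on the two
parties, which determine it from the previous messages. -/
theorem KeyProtocol.exists_round_condition (P : KeyProtocol p n) (i : Fin P.rounds) :
    ∃ (cA : (Fin n → 𝒳) → P.RangeA → (Fin P.rounds → P.Msg) → Prop)
      (cB : (Fin n → 𝒴) → P.RangeB → (Fin P.rounds → P.Msg) → Prop),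
      (∀ x m, MeasurableSet[P.measurableSpaceA] {q | cA x q m}) ∧
      (∀ y m, MeasurableSet[P.measurableSpaceB] {q | cB y q m}) ∧
      (∀ ω m, (∀ j < i, P.M j ω = m j) →
        (P.M i ω = m i ↔ cA (P.X ω) (P.QA ω) m ∧ cB (P.Y ω) (P.QB ω) m)) ∧
      (∀ x y qa qb m m', (∀ j < i, m j = m' j) → cA x qa m → cB y qb m → cA x qa m' →
        cB y qb m' → m i = m' i) := by
  let _ := P.measurableSpaceA
  let _ := P.measurableSpaceB
  have hlt : ∀ j : Fin i, j.castLE i.isLt.le < i := fun j => j.isLt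
  rcases P.isMessage i with ⟨φ, hφ, h⟩ | ⟨φ, hφ, h⟩
  -- The speaker's condition is that the message function returns `m i`; the listener's condition is
  -- void.
  · refine ⟨fun x q m => φ x q (fun j => m (j.castLE i.isLt.le)) = m i, fun _ _ _ => True,
      fun x m => hφ _ _ _, fun _ _ => by simp, fun ω m hm => ?_, ?_⟩
    · have hj : (fun j : Fin i => P.M (j.castLE i.isLt.le) ω) =
          fun j => m (j.castLE i.isLt.le) := funext fun j => hm _ (hlt j)
      simp [h ω, hj]
    · intro x y qa qb m m' hm h1 _ h2 _
      rw [← h1, ← h2, funext fun j => hm _ (hlt j)]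
  · refine ⟨fun _ _ _ => True, fun x q m => φ x q (fun j => m (j.castLE i.isLt.le)) = m i,
      fun _ _ => by simp, fun x m => hφ _ _ _, fun ω m hm => ?_, ?_⟩
    · have hj : (fun j : Fin i => P.M (j.castLE i.isLt.le) ω) =
          fun j => m (j.castLE i.isLt.le) := funext fun j => hm _ (hlt j)
      simp [h ω, hj]
    · intro x y qa qb m m' hm _ h1 _ h2
      rw [← h1, ← h2, funext fun j => hm _ (hlt j)]

/-- Transcript and outputs are described by rectangles in the parties' local data. -/
theorem KeyProtocol.exists_rectangles (P : KeyProtocol p n) :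
    ∃ (sA : (Fin n → 𝒳) → (Fin P.rounds → P.Msg) → P.Key → Set P.RangeA)
      (sB : (Fin n → 𝒴) → (Fin P.rounds → P.Msg) → P.Key → Set P.RangeB),
      (∀ x m u, MeasurableSet[P.measurableSpaceA] (sA x m u)) ∧
      (∀ y m u, MeasurableSet[P.measurableSpaceB] (sB y m u)) ∧
      (∀ ω m u v, ((fun i => P.M i ω) = m ∧ P.f ω = u ∧ P.g ω = v) ↔
        P.QA ω ∈ sA (P.X ω) m u ∧ P.QB ω ∈ sB (P.Y ω) m v) ∧
      (∀ x y qa qb m u v m' u' v', qa ∈ sA x m u → qb ∈ sB y m v → qa ∈ sA x m' u' →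
        qb ∈ sB y m' v' → m = m' ∧ u = u' ∧ v = v') := by
  let _ := P.measurableSpaceA
  let _ := P.measurableSpaceB
  choose cA cB hA hB hiff huniq using P.exists_round_condition
  obtain ⟨φ, hφ, hf⟩ := P.isOutput_f
  obtain ⟨ψ, hψ, hg⟩ := P.isOutput_g
  refine ⟨fun x m u => {q | (∀ i, cA i x q m) ∧ φ x q m = u},
    fun y m v => {q | (∀ i, cB i y q m) ∧ ψ y q m = v}, fun x m u => ?_, fun y m v => ?_, ?_, ?_⟩
  · exact (MeasurableSet.iInter fun i => hA i x m).inter (hφ x m u) |>.congr (by ext; simp)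
  · exact (MeasurableSet.iInter fun i => hB i y m).inter (hψ y m v) |>.congr (by ext; simp)
  · intro ω m u v
    have hM : (fun i => P.M i ω) = m ↔
        ∀ i, cA i (P.X ω) (P.QA ω) m ∧ cB i (P.Y ω) (P.QB ω) m := by
      constructor
      · rintro h i
        have h' : ∀ j, P.M j ω = m j := fun j => congrFun h j
        exact (hiff i ω m fun j _ => h' j).1 (h' i)
      -- Strong induction: the condition of round `i` describes `M i` only once all earlier messages
      -- agree with `m`.
      · intro h
        funext i
        induction i using WellFoundedLT.induction with
        | ind i ih => exact (hiff i ω m ih).2 (h i)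
    constructor
    · rintro ⟨h1, h2, h3⟩
      have h4 := hM.1 h1
      refine ⟨⟨fun i => (h4 i).1, ?_⟩, ⟨fun i => (h4 i).2, ?_⟩⟩
      · rw [← h2, hf ω, ← h1]
      · rw [← h3, hg ω, ← h1]
    · rintro ⟨⟨h1, h2⟩, ⟨h3, h4⟩⟩
      have h5 := hM.2 fun i => ⟨h1 i, h3 i⟩
      refine ⟨h5, ?_, ?_⟩
      · rw [hf ω, ← h2, ← h5]
      · rw [hg ω, ← h4, ← h5]
  · rintro x y qa qb m u v m' u' v' ⟨h1, h2⟩ ⟨h3, h4⟩ ⟨h5, h6⟩ ⟨h7, h8⟩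
    have hm : m = m' := by
      funext i
      induction i using WellFoundedLT.induction with
      | ind i ih => exact huniq i x y qa qb m m' ih (h1 i) (h3 i) (h5 i) (h7 i)
    subst hm
    exact ⟨rfl, h2.symm.trans h6, h4.symm.trans h8⟩

/-- The source σ-algebra in `indep` is pulled back from `⊤`, so `t` may be any set. -/
theorem KeyProtocol.measureReal_inter (P : KeyProtocol p n) {sA : Set P.RangeA}
    {sB : Set P.RangeB} {t : Set ((Fin n → 𝒳) × (Fin n → 𝒴) × (Fin n → 𝒵))}
    (hA : MeasurableSet[P.measurableSpaceA] sA) (hB : MeasurableSet[P.measurableSpaceB] sB) :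
    P.μ.real ({ω | (P.X ω, P.Y ω, P.Z ω) ∈ t} ∩ (P.QA ⁻¹' sA ∩ P.QB ⁻¹' sB)) =
      P.μ.real {ω | (P.X ω, P.Y ω, P.Z ω) ∈ t} *
        (P.μ.real (P.QA ⁻¹' sA) * P.μ.real (P.QB ⁻¹' sB)) := by
  have h := P.indep.meas_iInter (s := ![P.QA ⁻¹' sA, P.QB ⁻¹' sB,
    {ω | (P.X ω, P.Y ω, P.Z ω) ∈ t}]) (by
      intro i
      fin_cases i
      · exact ⟨sA, hA, rfl⟩
      · exact ⟨sB, hB, rfl⟩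
      · exact ⟨t, trivial, rfl⟩)
  rw [Fin.prod_univ_three] at h
  have e : (⋂ i, (![P.QA ⁻¹' sA, P.QB ⁻¹' sB, {ω | (P.X ω, P.Y ω, P.Z ω) ∈ t}] :
      Fin 3 → Set P.Ω) i) = {ω | (P.X ω, P.Y ω, P.Z ω) ∈ t} ∩ (P.QA ⁻¹' sA ∩ P.QB ⁻¹' sB) := by
    ext ω
    simp [Fin.forall_fin_succ]
    tauto
  rw [e] at h
  simp only [measureReal_def, h, ENNReal.toReal_mul]
  simp
  ring
end

/-! ### The intrinsic information bound. -/

section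
variable {𝒳 𝒴 𝒵 𝒥 : Type*} [Fintype 𝒳] [Fintype 𝒴] [Fintype 𝒵] [Fintype 𝒥]
  {p : 𝒳 × 𝒴 × 𝒵 → ℝ} {n : ℕ}

/-- The intrinsic information bound on the eavesdropper's equivocation about the key. -/
theorem KeyProtocol.eveEntropy_mul_log_two_le (P : KeyProtocol p n) (hp : ∀ a, 0 ≤ p a)
    (hp1 : ∑ a, p a = 1) {W : 𝒵 → 𝒥 → ℝ} (hW : ∀ z j, 0 ≤ W z j) (hW1 : ∀ z, ∑ j, W z j = 1) :
    P.eveEntropy * Real.log 2 ≤ n * ∑ j, infoSum (degrade p W j) + Real.log 3 +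
      (1 - P.μ.real {ω | P.f ω = P.K ω ∧ P.g ω = P.K ω}) *
        Real.log (2 * Fintype.card P.Key) := by
  classical
  let _ := P.measurableSpaceA
  let _ := P.measurableSpaceB
  obtain ⟨sA, sB, hA, hB, hiff, huniq⟩ := P.exists_rectangles
  have hmA : ∀ x m u, MeasurableSet (P.QA ⁻¹' sA x m u) := fun x m u => P.measurable_QA (hA x m u)
  have hmB : ∀ y m v, MeasurableSet (P.QB ⁻¹' sB y m v) := fun y m v => P.measurable_QB (hB y m v)
  have hset : ∀ x y z m u v, {ω | (P.X ω, P.Y ω, P.Z ω, (fun i => P.M i ω), P.f ω, P.g ω)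
      = (x, y, z, m, u, v)} = {ω | (P.X ω, P.Y ω, P.Z ω) ∈ ({(x, y, z)} : Set _)} ∩
        (P.QA ⁻¹' sA x m u ∩ P.QB ⁻¹' sB y m v) := by
    intro x y z m u v
    ext ω
    have h := hiff ω m u v
    constructor
    · intro hω
      simp only [Set.mem_ofPred_eq, Prod.mk.injEq] at hω
      obtain ⟨hx, hy, hz, hM⟩ := hω
      have := h.1 hM
      rw [hx, hy] at this
      exact ⟨by simp [hx, hy, hz], this⟩
    · rintro ⟨h1, h2⟩
      simp only [Set.mem_singleton_iff, Set.mem_ofPred_eq, Prod.mk.injEq] at h1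
      obtain ⟨hx, hy, hz⟩ := h1
      have h3 := h.2 (by rw [hx, hy]; exact h2)
      simp only [Set.mem_ofPred_eq, Prod.mk.injEq]
      exact ⟨hx, hy, hz, h3⟩
  -- Measurability of messages and outputs comes from the rectangles.
  have hmeas : ∀ t, MeasurableSet {ω | (P.K ω, P.X ω, P.Y ω, P.Z ω, (fun i => P.M i ω),
      P.f ω, P.g ω) = t} := by
    rintro ⟨k, x, y, z, m, u, v⟩
    have : {ω | (P.K ω, P.X ω, P.Y ω, P.Z ω, (fun i => P.M i ω), P.f ω, P.g ω)
        = (k, x, y, z, m, u, v)} = {ω | P.K ω = k} ∩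
        {ω | (P.X ω, P.Y ω, P.Z ω, (fun i => P.M i ω), P.f ω, P.g ω) = (x, y, z, m, u, v)} := by
      ext ω
      simp
    rw [this, hset]
    exact (P.measurable_K k).inter ((P.measurable_source x y z).inter
      ((hmA x m u).inter (hmB y m v)))
  have hfac : ∀ x y z m u v, law P.μ (fun ω => (P.X ω, P.Y ω, P.Z ω, (fun i => P.M i ω),
      P.f ω, P.g ω)) (x, y, z, m, u, v) = (∏ i, p (x i, y i, z i)) *
        (P.μ.real (P.QA ⁻¹' sA x m u) * P.μ.real (P.QB ⁻¹' sB y m v)) := by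
    intro x y z m u v
    rw [law, hset, P.measureReal_inter (hA x m u) (hB y m v), ← P.law_source x y z]
    rfl
  -- For fixed inputs `x`, `y`, the rectangles of distinct transcripts and outputs are disjoint
  -- events, whether or not `(x, y)` has positive probability.
  have hαβ : ∀ x y, ∑ m, ∑ u, ∑ v, P.μ.real (P.QA ⁻¹' sA x m u) * P.μ.real (P.QB ⁻¹' sB y m v)
      ≤ 1 := by
    intro x y
    have h1 : ∀ m u v, P.μ.real (P.QA ⁻¹' sA x m u) * P.μ.real (P.QB ⁻¹' sB y m v) =
        P.μ.real (P.QA ⁻¹' sA x m u ∩ P.QB ⁻¹' sB y m v) := by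
      intro m u v
      have := P.measureReal_inter (t := Set.univ) (hA x m u) (hB y m v)
      simpa using this.symm
    have h2 := sum_measureReal_le_measureReal_univ (μ := P.μ) (s := Finset.univ)
      (t := fun t : (Fin P.rounds → P.Msg) × P.Key × P.Key =>
        P.QA ⁻¹' sA x t.1 t.2.1 ∩ P.QB ⁻¹' sB y t.1 t.2.2)
      (fun t _ => ((hmA _ _ _).inter (hmB _ _ _)))
      (by
        rintro ⟨m, u, v⟩ _ ⟨m', u', v'⟩ _ hne
        refine Set.disjoint_left.2 fun ω h h' => hne ?_
        obtain ⟨rfl, rfl, rfl⟩ := huniq x y _ _ m u v m' u' v' h.1 h.2 h'.1 h'.2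
        rfl)
    simp only [h1]
    simpa [Fintype.sum_prod_type] using h2
  -- `γ` is the law of `X` given `j` and `η` the joint law of `Y` and `j`, so `γ * η` makes `X` and
  -- `Y` independent given `j`.
  set q : 𝒳 → 𝒴 → 𝒥 → ℝ := fun x y j => degrade p W j (x, y) with hq
  set γ : 𝒳 → 𝒥 → ℝ := fun x j => margFst (degrade p W j) x / ∑ b, margSnd (degrade p W j) b
    with hγ
  set η : 𝒴 → 𝒥 → ℝ := fun y j => margSnd (degrade p W j) y with hη
  have hq0 : ∀ x y j, 0 ≤ q x y j := fun x y j => degrade_nonneg hp hW j _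
  have hη0 : ∀ y j, 0 ≤ η y j := fun y j => margSnd_nonneg (degrade_nonneg hp hW j) y
  have hγ0 : ∀ x j, 0 ≤ γ x j := fun x j =>
    div_nonneg (margFst_nonneg (degrade_nonneg hp hW j) x) (Finset.sum_nonneg fun y _ => hη0 y j)
  have hac : ∀ x y j, 0 < q x y j → 0 < γ x j * η y j := by
    intro x y j h
    have h2 := margSnd_pos (degrade_nonneg hp hW j) h
    exact mul_pos (div_pos (margFst_pos (degrade_nonneg hp hW j) h)
      (sum_margSnd_pos (degrade_nonneg hp hW j) h2)) h2
  have hqn : ∀ (x : Fin n → 𝒳) (y : Fin n → 𝒴) (d : Fin n → 𝒥),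
      ∑ z : Fin n → 𝒵, (∏ i, p (x i, y i, z i)) * ∏ i, W (z i) (d i) =
        ∏ i, q (x i) (y i) (d i) := by
    intro x y d
    simp only [hq, degrade]
    rw [Fintype.prod_sum]
    exact Finset.sum_congr rfl fun z _ => Finset.prod_mul_distrib.symm
  have main := condEntropy_le_of_factorization (μ := P.μ) hmeas
    (p := fun x y z => ∏ i, p (x i, y i, z i))
    (α := fun x m u => P.μ.real (P.QA ⁻¹' sA x m u))
    (β := fun y m v => P.μ.real (P.QB ⁻¹' sB y m v))
    (W := fun z d : Fin n → _ => ∏ i, W (z i) (d i))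
    (γ := fun x d : Fin n → _ => ∏ i, γ (x i) (d i))
    (η := fun y d : Fin n → _ => ∏ i, η (y i) (d i))
    (fun _ _ => Finset.prod_nonneg fun _ _ => hγ0 _ _)
    (fun _ _ => Finset.prod_nonneg fun _ _ => hη0 _ _)
    (fun _ _ _ => measureReal_nonneg) (fun _ _ _ => measureReal_nonneg)
    (fun _ _ => Finset.prod_nonneg fun _ _ => hW _ _)
    (fun z => by rw [← Fintype.prod_sum]; simp [hW1])
    (by
      simp only [← Finset.prod_mul_distrib]
      rw [sum_prod_three (fun _ x y j => γ x j * η y j)]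
      refine Finset.prod_le_one (fun _ _ => ?_) fun _ _ => sum_condIndep_le_one hp hp1 hW hW1
      exact Finset.sum_nonneg fun _ _ => Finset.sum_nonneg fun _ _ => Finset.sum_nonneg fun _ _ =>
        mul_nonneg (hγ0 _ _) (hη0 _ _))
    hαβ (fun x y z => P.law_source x y z) hfac
    (fun x y d h => by
      rw [hqn] at h
      rw [← Finset.prod_mul_distrib]
      refine Finset.prod_pos fun i _ => hac _ _ _ (lt_of_le_of_ne (hq0 _ _ _) fun h0 => ?_)
      exact h.ne' (Finset.prod_eq_zero (Finset.mem_univ i) h0.symm))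
  simp only [hqn] at main
  simp only [← Finset.prod_mul_distrib] at main
  rw [sum_prod_mul_log_prod (r := fun x y j => γ x j * η y j) hq0 hac
    ((sum_degrade hW1).trans hp1), Fintype.card_fin] at main
  rw [sum_infoSum_degrade]
  exact main

theorem IsAchievableKeyRate.mul_log_two_le {R : ℝ} (hR : IsAchievableKeyRate p R)
    (hp : ∀ a, 0 ≤ p a) (hp1 : ∑ a, p a = 1) {W : 𝒵 → 𝒥 → ℝ} (hW : ∀ z j, 0 ≤ W z j)
    (hW1 : ∀ z, ∑ j, W z j = 1) : R * Real.log 2 ≤ ∑ j, infoSum (degrade p W j) := by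
  set I := ∑ j, infoSum (degrade p W j)
  have hl2 : 0 < Real.log 2 := Real.log_pos (by norm_num)
  have hl3 : 0 < Real.log 3 := Real.log_pos (by norm_num)
  have key : ∀ ε : ℝ, 0 < ε → ε < 1 → (1 - ε) * (R * Real.log 2) ≤ I := by
    intro ε hε hε1
    obtain ⟨N, hN⟩ := hR ε hε
    -- `log 3` comes from the change of measure, one `log 2` from the secrecy slack, the other from
    -- `log (2 |𝒦|)` on the failure event.
    have bound : ∀ n : ℕ, N ≤ n → 0 < n →
        (1 - ε) * (R * Real.log 2) ≤ I + (Real.log 3 + 2 * Real.log 2) / n := by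
      intro n hn hn0
      obtain ⟨P, h1, h2, h3⟩ := hN n hn
      have hn0' : (0 : ℝ) < n := by exact_mod_cast hn0
      have : Nonempty P.Ω := P.μ.nonempty_of_neZero
      have : Nonempty P.Key := Nonempty.map P.K this
      have hc : (1 : ℝ) ≤ Fintype.card P.Key := by exact_mod_cast Fintype.card_pos
      have hE := P.eveEntropy_mul_log_two_le hp hp1 hW hW1
      set L := Real.log (Fintype.card P.Key) with hL
      have hL0 : 0 ≤ L := Real.log_nonneg hc
      rw [Real.log_mul (by norm_num) (by positivity), ← hL] at hE
      have e : Real.logb 2 (Fintype.card P.Key) * Real.log 2 = L := by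
        rw [Real.logb, div_mul_cancel₀ _ hl2.ne']
      have h4 : L - P.eveEntropy * Real.log 2 < ε * Real.log 2 := by
        rw [← e, ← sub_mul]; exact mul_lt_mul_of_pos_right h2 hl2
      have h5 : n * (R * Real.log 2) ≤ L := by
        rw [← e, ← mul_assoc]
        refine mul_le_mul_of_nonneg_right ?_ hl2.le
        rw [one_div, ← div_eq_inv_mul, le_div_iff₀ hn0'] at h3
        linarith
      have h6 : (1 - P.μ.real {ω | P.f ω = P.K ω ∧ P.g ω = P.K ω}) * (Real.log 2 + L) ≤
          ε * (Real.log 2 + L) :=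
        mul_le_mul_of_nonneg_right (by linarith) (by linarith)
      have h7 : (1 - ε) * (n * (R * Real.log 2)) ≤ (1 - ε) * L :=
        mul_le_mul_of_nonneg_left h5 (by linarith)
      have h8 : ε * Real.log 2 ≤ Real.log 2 := mul_le_of_le_one_left hl2.le hε1.le
      have h9 : ((1 - ε) * (R * Real.log 2)) * n ≤
          (I + (Real.log 3 + 2 * Real.log 2) / n) * n := by
        rw [add_mul, div_mul_cancel₀ _ hn0'.ne']
        linarith
      exact le_of_mul_le_mul_right h9 hn0'
    have lim : Filter.Tendsto (fun n : ℕ => I + (Real.log 3 + 2 * Real.log 2) / (n : ℝ))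
        Filter.atTop (nhds (I + 0)) :=
      tendsto_const_nhds.add (tendsto_const_div_atTop_nhds_zero_nat _)
    rw [add_zero] at lim
    refine ge_of_tendsto lim ?_
    filter_upwards [Filter.eventually_ge_atTop N, Filter.eventually_gt_atTop 0] with n h1 h2
    exact bound n h1 h2
  have lim : Filter.Tendsto (fun ε : ℝ => (1 - ε) * (R * Real.log 2)) (nhdsWithin 0 (Set.Ioi 0))
      (nhds ((1 - 0) * (R * Real.log 2))) := by
    refine Filter.Tendsto.mono_left ?_ nhdsWithin_le_nhds
    exact Continuous.tendsto (by fun_prop) 0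
  rw [sub_zero, one_mul] at lim
  refine le_of_tendsto lim ?_
  filter_upwards [self_mem_nhdsWithin,
    (eventually_lt_nhds (zero_lt_one (α := ℝ))).filter_mono nhdsWithin_le_nhds] with ε h1 h2
  exact key ε h1 h2

/-! ### Merging two symbols of `Z`, and the conclusion. -/

theorem condMutualInfo_mul_log_two (hp : ∀ a, 0 ≤ p a) :
    condMutualInfo p * Real.log 2 = ∑ z, infoSum (fun a : 𝒳 × 𝒴 => p (a.1, a.2, z)) := by
  have hl2 : Real.log 2 ≠ 0 := (Real.log_pos (by norm_num)).ne'
  rw [condMutualInfo, Finset.sum_mul]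
  refine Finset.sum_congr rfl fun z _ => ?_
  have h := mul_mutualInfo_eq_infoSum (q := fun a : 𝒳 × 𝒴 => p (a.1, a.2, z)) (fun _ => hp _)
  have e : ∑ a : 𝒳 × 𝒴, p (a.1, a.2, z) = margZ p z := by
    rw [margZ, Fintype.sum_prod_type]
  rw [e] at h
  rw [eq_div_iff hl2] at h
  exact h

/-- There is a channel acting on `Z` that decreases the conditional mutual information as soon as
some merging of a symbol `z₁` into a symbol `z₀` does. -/
theorem exists_channel_of_infoSum_lt (hp : ∀ a, 0 ≤ p a) {z₀ z₁ : 𝒵} (hne : z₀ ≠ z₁) {δ : ℝ}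
    (hδ0 : 0 ≤ δ) (hδ1 : δ ≤ 1)
    (h : infoSum (fun a : 𝒳 × 𝒴 => p (a.1, a.2, z₀) + δ * p (a.1, a.2, z₁)) <
      infoSum (fun a : 𝒳 × 𝒴 => p (a.1, a.2, z₀)) +
        δ * infoSum (fun a : 𝒳 × 𝒴 => p (a.1, a.2, z₁))) :
    ∃ W : 𝒵 → 𝒵 → ℝ, (∀ z j, 0 ≤ W z j) ∧ (∀ z, ∑ j, W z j = 1) ∧
      ∑ j, infoSum (degrade p W j) < condMutualInfo p * Real.log 2 := by
  classical
  -- `z₁` moves to `z₀` with probability `δ` and stays otherwise; all other symbols are fixed.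
  set W : 𝒵 → 𝒵 → ℝ := fun z j => if z = z₁ then
    (if j = z₀ then δ else 0) + (if j = z₁ then 1 - δ else 0) else if j = z then 1 else 0 with hW
  refine ⟨W, fun z j => ?_, fun z => ?_, ?_⟩
  · have : 0 ≤ 1 - δ := by linarith
    simp only [hW]
    split_ifs <;> positivity
  · simp only [hW]
    split_ifs
    · simp [Finset.sum_add_distrib]
    · simp
  · rw [condMutualInfo_mul_log_two hp]
    have d : ∀ j, degrade p W j = fun a : 𝒳 × 𝒴 => (if j = z₁ then 0 else p (a.1, a.2, j)) +
        ((if j = z₀ then δ else 0) + (if j = z₁ then 1 - δ else 0)) * p (a.1, a.2, z₁) := by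
      intro j
      ext a
      have : ∀ z, p (a.1, a.2, z) * W z j =
          (if z = j then if j = z₁ then 0 else p (a.1, a.2, j) else 0) +
          if z = z₁ then ((if j = z₀ then δ else 0) + (if j = z₁ then 1 - δ else 0)) *
            p (a.1, a.2, z₁) else 0 := by
        intro z
        simp only [hW]
        by_cases h1 : z = z₁
        · subst h1
          by_cases h2 : z = j
          · subst h2; simp [mul_comm]
          · simp [h2, mul_comm]
        · by_cases h2 : z = j
          · subst h2; simp [h1]
          · simp [h1, h2, Ne.symm h2]
      simp only [degrade, this, Finset.sum_add_distrib]
      simp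
    have d0 : degrade p W z₀ = fun a : 𝒳 × 𝒴 => p (a.1, a.2, z₀) + δ * p (a.1, a.2, z₁) := by
      rw [d]; simp [hne]
    have d1 : degrade p W z₁ = fun a : 𝒳 × 𝒴 => (1 - δ) * p (a.1, a.2, z₁) := by
      rw [d]; simp [hne.symm]
    have d2 : ∀ j ∈ (Finset.univ.erase z₁).erase z₀,
        infoSum (degrade p W j) = infoSum (fun a : 𝒳 × 𝒴 => p (a.1, a.2, j)) := by
      intro j hj
      simp only [Finset.mem_erase, Finset.mem_univ, and_true] at hj
      rw [d]; simp [hj.1, hj.2]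
    have hmem : z₀ ∈ Finset.univ.erase z₁ := by simp [hne]
    rw [← Finset.add_sum_erase _ _ (Finset.mem_univ z₁), ← Finset.add_sum_erase _ _ hmem,
      ← Finset.add_sum_erase _ _ (Finset.mem_univ z₁), ← Finset.add_sum_erase _ _ hmem,
      Finset.sum_congr rfl d2, d0, d1, infoSum_smul]
    linarith

theorem twoWayKeyRate_lt_of_channel (hp : p ∈ stdSimplex ℝ (𝒳 × 𝒴 × 𝒵)) {W : 𝒵 → 𝒥 → ℝ}
    (hW : ∀ z j, 0 ≤ W z j) (hW1 : ∀ z, ∑ j, W z j = 1)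
    (h : ∑ j, infoSum (degrade p W j) < condMutualInfo p * Real.log 2) :
    twoWayKeyRate p < (condMutualInfo p : EReal) := by
  have hl2 : 0 < Real.log 2 := Real.log_pos (by norm_num)
  refine lt_of_le_of_lt (b := (((∑ j, infoSum (degrade p W j)) / Real.log 2 : ℝ) : EReal)) ?_ ?_
  · refine sSup_le ?_
    rintro _ ⟨R, hR, rfl⟩
    rw [EReal.coe_le_coe_iff, le_div_iff₀ hl2]
    exact IsAchievableKeyRate.mul_log_two_le hR hp.1 hp.2 hW hW1
  · rw [EReal.coe_lt_coe_iff, div_lt_iff₀ hl2]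
    exact h

theorem supp_margFst_condXY {𝒳 𝒴 𝒵 : Type*} [Fintype 𝒳] [Fintype 𝒴] {p : 𝒳 × 𝒴 × 𝒵 → ℝ}
    {z : 𝒵} (hz : 0 < margZ p z) :
    supp (margFst (condXY p z)) = supp (margFst fun a : 𝒳 × 𝒴 => p (a.1, a.2, z)) := by
  ext x
  simp only [supp, margFst, condXY, ← Finset.sum_div, Set.mem_ofPred_eq]
  exact div_pos_iff_of_pos_right hz

theorem supp_margSnd_condXY {𝒳 𝒴 𝒵 : Type*} [Fintype 𝒳] [Fintype 𝒴] {p : 𝒳 × 𝒴 × 𝒵 → ℝ}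
    {z : 𝒵} (hz : 0 < margZ p z) :
    supp (margSnd (condXY p z)) = supp (margSnd fun a : 𝒳 × 𝒴 => p (a.1, a.2, z)) := by
  ext x
  simp only [supp, margSnd, condXY, ← Finset.sum_div, Set.mem_ofPred_eq]
  exact div_pos_iff_of_pos_right hz
end

theorem theorem3 {𝒳 𝒴 𝒵 : Type*} [Fintype 𝒳] [Fintype 𝒴] [Fintype 𝒵]
    (p : 𝒳 × 𝒴 × 𝒵 → ℝ) (hp : p ∈ stdSimplex ℝ (𝒳 × 𝒴 × 𝒵))
    (z₀ z₁ : 𝒵) (hz : SuppBelow (condXY p z₁) (condXY p z₀))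
    (hxy : ∃ x ∈ supp (margFst (condXY p z₀)), ∃ y ∈ supp (margSnd (condXY p z₀)),
      0 < condXY p z₁ (x, y) ∧ condXY p z₀ (x, y) = 0) :
    twoWayKeyRate p < (condMutualInfo p : EReal) := by
  obtain ⟨x, hx, y, hy, h1, h0⟩ := hxy
  have hp0 := hp.1
  have hZ : ∀ z, 0 ≤ margZ p z := fun z =>
    Finset.sum_nonneg fun _ _ => Finset.sum_nonneg fun _ _ => hp0 _
  -- Positivity of both symbols is implicit: a symbol of probability zero has `condXY` equal to zero
  -- by division by zero, contradicting `h1` or `hx`.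
  have hZ1 : 0 < margZ p z₁ := (hZ z₁).lt_of_ne' fun h => by simp [condXY, h] at h1
  have hZ0 : 0 < margZ p z₀ := (hZ z₀).lt_of_ne' fun h => by
    simp [condXY, h, supp, margFst] at hx
  have hne : z₀ ≠ z₁ := by rintro rfl; exact h1.ne' h0
  have h1' : 0 < p (x, y, z₁) := (div_pos_iff_of_pos_right hZ1).1 h1
  have h0' : p (x, y, z₀) = 0 := (div_eq_zero_iff.1 h0).resolve_right hZ0.ne'
  rw [supp_margFst_condXY hZ0] at hx
  rw [supp_margSnd_condXY hZ0] at hy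
  have key : ∀ᶠ δ : ℝ in nhdsWithin 0 (Set.Ioi 0),
      infoSum (fun a : 𝒳 × 𝒴 => p (a.1, a.2, z₀) + δ * p (a.1, a.2, z₁)) <
      infoSum (fun a : 𝒳 × 𝒴 => p (a.1, a.2, z₀)) +
        δ * infoSum (fun a : 𝒳 × 𝒴 => p (a.1, a.2, z₁)) := by
    rcases hz with hz | hz
    · have hs := hz.1
      rw [supp_margFst_condXY hZ0, supp_margFst_condXY hZ1] at hs
      exact eventually_infoSum_add_smul_lt (fun _ => hp0 _) (fun _ => hp0 _) hs hy h0' h1'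
    -- With the roles exchanged, the expansion is applied to the transposed slices and carried back
    -- by `infoSum_swap`.
    · have hs : supp (margSnd (condXY p z₁)) ⊆ supp (margSnd (condXY p z₀)) := hz.1
      rw [supp_margSnd_condXY hZ0, supp_margSnd_condXY hZ1] at hs
      have h := eventually_infoSum_add_smul_lt (q₀ := fun a : 𝒴 × 𝒳 => p (a.2, a.1, z₀))
        (q₁ := fun a : 𝒴 × 𝒳 => p (a.2, a.1, z₁)) (fun _ => hp0 _) (fun _ => hp0 _) hs
        (x := y) (y := x) hx h0' h1'
      filter_upwards [h, self_mem_nhdsWithin] with δ hδ (hδ0 : 0 < δ)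
      have e0 := infoSum_swap (q := fun a : 𝒳 × 𝒴 => p (a.1, a.2, z₀)) fun _ => hp0 _
      have e1 := infoSum_swap (q := fun a : 𝒳 × 𝒴 => p (a.1, a.2, z₁)) fun _ => hp0 _
      have e2 := infoSum_swap
        (q := fun a : 𝒳 × 𝒴 => p (a.1, a.2, z₀) + δ * p (a.1, a.2, z₁))
        fun _ => add_nonneg (hp0 _) (mul_nonneg hδ0.le (hp0 _))
      rw [← e0, ← e1, ← e2]
      exact hδ
  obtain ⟨δ, hδ, hδ0 : 0 < δ, hδ1⟩ := (key.and (Filter.Eventually.and self_mem_nhdsWithin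
    ((eventually_lt_nhds (zero_lt_one (α := ℝ))).filter_mono nhdsWithin_le_nhds))).exists
  obtain ⟨W, hW, hW1, hlt⟩ := exists_channel_of_infoSum_lt hp0 hne hδ0.le hδ1.le hδ
  exact twoWayKeyRate_lt_of_channel hp hW hW1 hlt
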